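/- For real numbers $\beta,\tau,\mu$ let $$\hat U_{\beta,\tau,\mu}=e^{-i\frac{\tau}{2}\left(-i\frac{d}{d\theta}+\beta\right)^2}\,e^{-i\mu\cos\theta}$$ be the quantum kicked rotor propagator, a unitary operator on $L^2([0,2\pi])$ with periodic boundary conditions, and let $(\hat T\psi)(\theta)=e^{i\theta}\psi(\theta)$. Suppose that $(\beta,\tau)$ is at a primitive resonance of order $q$: $\tau=2\pi p/q$ with $p\in\mathbb Z$, $q\ge 1$ coprime, and $q$ is the least positive integer $Q$ such that $\hat U_{\beta,\tau,\mu}$ commutes with $\hat T^{Q}$ (equivalently, $\tau=2\pi p/q$ with $p,q$ coprime and $p\beta+\tfrac{pq}{2}\in\mathbb Z$). For $\vartheta\in(0,2\pi/q)$ let $S(\vartheta,\mu)$ be the $q\times q$ Floquet–Bloch matrix $$S_{jk}(\vartheta,\mu)=e^{-i\mu\cos(\vartheta+2\pi(j-1)/q)}\,G_{jk},\qquad G_{jk}=\frac1q\sum_{s=0}^{q-1}e^{2\pi i s(j-k)/q}\,a_{s+1},\qquad a_r=e^{-i\pi p(r+\beta-1)^2/q},$$ $1\le j,k,r\le q$,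 and let $w_1(\vartheta,\mu),\dots,w_q(\vartheta,\mu)$ be its (unimodular) eigenvalues, counted with multiplicity and numbered in any way with $w_j(\vartheta,0)=a_j$. If $\mu\neq 0$, then: 1. no band is flat: for no $j$ is the eigenangle $\arg w_j(\vartheta,\mu)$ constant for $\vartheta\in(0,2\pi/q)$; 2. the spectrum of $\hat U_{\beta,\tau,\mu}$ is purely absolutely continuous: the spectral measure of every $\psi\in L^2([0,2\pi])$ with respect to $\hat U_{\beta,\tau,\mu}$ is absolutely continuous with respect to Lebesgue measure on the circle. -/

import Mathlib

open MeasureTheory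

noncomputable section

namespace KickedRotor

instance factTwoPiPos : Fact (0 < 2 * Real.pi) := ⟨Real.two_pi_pos⟩

/-- The circle `ℝ / 2πℤ`. -/
abbrev Torus : Type := AddCircle (2 * Real.pi)

/-- The Hilbert space `L²([0, 2π])` (periodic functions, normalised Lebesgue measure). -/
abbrev L2Torus : Type := Lp ℂ 2 (AddCircle.haarAddCircle : Measure Torus)

/-- The Hilbert space `ℓ²(ℤ)` of Fourier coefficients. -/
abbrev Seq2 : Type := lp (fun _ : ℤ => ℂ) 2

/-! ### Multiplication by unimodular functions and sequences -/

theorem memLp_mul (g : C(Torus, Circle)) (f : L2Torus) :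
    MemLp (fun x => (g x : ℂ) * f x) 2 (AddCircle.haarAddCircle : Measure Torus) := by
  have hf := Lp.memLp f
  have hg : Continuous (fun x => (g x : ℂ)) := by fun_prop
  refine hf.of_le (hg.aestronglyMeasurable.mul hf.1) ?_
  exact Filter.Eventually.of_forall fun x => by simp [Circle.norm_coe]

/-- Multiplication by a continuous unimodular function `g`, as a unitary operator on `L²`. -/
def mulOp (g : C(Torus, Circle)) : L2Torus ≃ₗᵢ[ℂ] L2Torus where
  toFun f := (memLp_mul g f).toLp _
  invFun f := (memLp_mul g⁻¹ f).toLp _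
  map_add' f₁ f₂ := by
    apply Lp.ext
    filter_upwards [(memLp_mul g (f₁ + f₂)).coeFn_toLp, (memLp_mul g f₁).coeFn_toLp,
      (memLp_mul g f₂).coeFn_toLp, Lp.coeFn_add f₁ f₂,
      Lp.coeFn_add ((memLp_mul g f₁).toLp _) ((memLp_mul g f₂).toLp _)] with x h1 h2 h3 h4 h5
    rw [h1, h5, Pi.add_apply, h2, h3, h4, Pi.add_apply, mul_add]
  map_smul' c f := by
    apply Lp.ext
    filter_upwards [(memLp_mul g (c • f)).coeFn_toLp, (memLp_mul g f).coeFn_toLp,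
      Lp.coeFn_smul c f, Lp.coeFn_smul c ((memLp_mul g f).toLp _)] with x h1 h2 h3 h4
    rw [h1, RingHom.id_apply, h4, Pi.smul_apply, h2, h3, Pi.smul_apply, smul_eq_mul, smul_eq_mul]
    ring
  left_inv f := by
    apply Lp.ext
    filter_upwards [(memLp_mul g⁻¹ ((memLp_mul g f).toLp _)).coeFn_toLp,
      (memLp_mul g f).coeFn_toLp] with x h1 h2
    rw [h1, h2, ← mul_assoc, ← Circle.coe_mul]
    simp
  right_inv f := by
    apply Lp.ext
    filter_upwards [(memLp_mul g ((memLp_mul g⁻¹ f).toLp _)).coeFn_toLp,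
      (memLp_mul g⁻¹ f).coeFn_toLp] with x h1 h2
    rw [h1, h2, ← mul_assoc, ← Circle.coe_mul]
    simp
  norm_map' f := by
    change ‖(memLp_mul g f).toLp _‖ = ‖f‖
    rw [Lp.norm_toLp, Lp.norm_def]
    congr 1
    exact eLpNorm_congr_norm_ae (Filter.Eventually.of_forall fun x => by simp [Circle.norm_coe])

theorem memℓp_mul (u : ℤ → Circle) (c : Seq2) :
    Memℓp (fun n => (u n : ℂ) * c n) 2 := by
  have hc := lp.memℓp c
  rw [memℓp_gen_iff (by norm_num)] at hc ⊢
  simpa [Circle.norm_coe] using hc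

/-- Multiplication by a unimodular sequence `u`, as a unitary operator on `ℓ²(ℤ)`. -/
def seqMulOp (u : ℤ → Circle) : Seq2 ≃ₗᵢ[ℂ] Seq2 where
  toFun c := ⟨fun n => (u n : ℂ) * c n, memℓp_mul u c⟩
  invFun c := ⟨fun n => ((u⁻¹) n : ℂ) * c n, memℓp_mul u⁻¹ c⟩
  map_add' c₁ c₂ := by
    ext n
    exact mul_add _ _ _
  map_smul' a c := by
    ext n
    exact mul_left_comm _ _ _
  left_inv c := by
    ext n
    change ((u n)⁻¹ : Circle) * ((u n : ℂ) * c n) = c n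
    rw [← mul_assoc, ← Circle.coe_mul]
    simp
  right_inv c := by
    ext n
    change (u n : ℂ) * (((u n)⁻¹ : Circle) * c n) = c n
    rw [← mul_assoc, ← Circle.coe_mul]
    simp
  norm_map' c := by
    rw [lp.norm_eq_tsum_rpow (by norm_num), lp.norm_eq_tsum_rpow (by norm_num)]
    congr 1
    exact tsum_congr fun n => by
      change ‖(u n : ℂ) * c n‖ ^ _ = _
      simp [Circle.norm_coe]

/-! ### The kicked rotor -/

/-- The cosine, as a continuous function on the circle `ℝ / 2πℤ`. -/
def cosTorus : C(Torus, ℝ) where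
  toFun := Real.cos_periodic.lift
  continuous_toFun := Continuous.quotient_lift Real.continuous_cos _

/-- The kick `e^{-iμ cos θ}`. -/
def kick (μ : ℝ) : L2Torus ≃ₗᵢ[ℂ] L2Torus :=
  mulOp ⟨fun θ => Circle.exp (-(μ * cosTorus θ)), by fun_prop⟩

/-- The free rotation `e^{-i(τ/2)(-i d/dθ + β)²}`: it multiplies the `n`-th Fourier coefficient
by `e^{-i(τ/2)(n + β)²}`. -/
def freeRotation (β τ : ℝ) : L2Torus ≃ₗᵢ[ℂ] L2Torus :=
  ((fourierBasis (T := 2 * Real.pi)).repr.trans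
    (seqMulOp fun n => Circle.exp (-(τ / 2 * ((n : ℝ) + β) ^ 2)))).trans
      (fourierBasis (T := 2 * Real.pi)).repr.symm

/-- The propagator `U_{β,τ,μ} = e^{-i(τ/2)(-i d/dθ + β)²} e^{-iμ cos θ}` (product of operators). -/
def propagator (β τ μ : ℝ) : L2Torus ≃ₗᵢ[ℂ] L2Torus :=
  freeRotation β τ * kick μ

/-- The momentum translation `(T ψ)(θ) = e^{iθ} ψ(θ)`. -/
def momentumShift : L2Torus ≃ₗᵢ[ℂ] L2Torus :=
  mulOp ⟨fun θ => AddCircle.toCircle θ, AddCircle.continuous_toCircle⟩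

/-- `Q` is the length of the resonance: the least positive integer such that `U_{β,τ,μ}` commutes
with `T^Q`. -/
def IsResonanceLength (β τ μ : ℝ) (Q : ℕ) : Prop :=
  IsLeast {Q : ℕ | 0 < Q ∧ Commute (propagator β τ μ) (momentumShift ^ Q)} Q

/-- A primitive resonance of order `q`: `τ = 2πp/q` with `p`, `q` coprime, and the length of the
resonance equals `q`. -/
def IsPrimitiveResonance (β τ μ : ℝ) (p : ℤ) (q : ℕ) : Prop :=
  0 < q ∧ IsCoprime p (q : ℤ) ∧ τ = 2 * Real.pi * p / q ∧ IsResonanceLength β τ μ q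

/-! ### The Floquet–Bloch matrix and its bands (indices run from `0` to `Q - 1`) -/

/-- `a_{s+1} = e^{-iπp(s+β)²/q}`. -/
def freeEigenvalue (p : ℤ) (q : ℕ) (β : ℝ) (s : ℕ) : ℂ :=
  Complex.exp (-Complex.I * Real.pi * p * ((s : ℂ) + β) ^ 2 / q)

/-- `G_{jk} = (1/Q) ∑_{s=0}^{Q-1} e^{2πis(j-k)/Q} a_{s+1}`. -/
def freeMatrix (Q : ℕ) (p : ℤ) (q : ℕ) (β : ℝ) : Matrix (Fin Q) (Fin Q) ℂ :=
  Matrix.of fun j k => (1 / (Q : ℂ)) * ∑ s ∈ Finset.range Q,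
    Complex.exp (2 * Real.pi * Complex.I * s * ((j : ℂ) - (k : ℂ)) / Q) * freeEigenvalue p q β s

/-- `S_{jk}(ϑ, μ) = e^{-iμ cos(ϑ + 2πj/Q)} G_{jk}`. -/
def blochMatrix (Q : ℕ) (p : ℤ) (q : ℕ) (β ϑ μ : ℝ) : Matrix (Fin Q) (Fin Q) ℂ :=
  Matrix.of fun j k =>
    Complex.exp (-Complex.I * μ * Real.cos (ϑ + 2 * Real.pi * (j : ℝ) / Q)) *
      freeMatrix Q p q β j k

/-- `w_j(ϑ, μ)` is a numbering of the eigenvalues of `S(ϑ, μ)`, with multiplicities, such that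
`w_j(ϑ, 0) = a_j`. No regularity in `ϑ` or `μ` is required, so that every numbering by continuous
or analytic branches is included. -/
def IsEigenvalueNumbering (Q : ℕ) (p : ℤ) (q : ℕ) (β : ℝ) (w : Fin Q → ℝ → ℝ → ℂ) : Prop :=
  (∀ ϑ ∈ Set.Ioo 0 (2 * Real.pi / Q), ∀ μ : ℝ,
    (blochMatrix Q p q β ϑ μ).charpoly.roots = Finset.univ.val.map fun j => w j ϑ μ) ∧
  ∀ ϑ ∈ Set.Ioo 0 (2 * Real.pi / Q), ∀ j, w j ϑ 0 = freeEigenvalue p q β j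

/-- The band swept by the eigenangle `arg w(ϑ)`, `ϑ ∈ (0, 2π/Q)`, is flat: the eigenangle is
constant. -/
def IsFlatBand (Q : ℕ) (w : ℝ → ℂ) : Prop :=
  ∃ α : ℝ, ∀ ϑ ∈ Set.Ioo 0 (2 * Real.pi / Q), Complex.arg (w ϑ) = α

/-! ### Purely absolutely continuous spectrum -/

/-- `m` is the spectral measure of the vector `ψ` for the unitary operator `U`, in terms of the
eigenangle: the finite measure on `ℝ / 2πℤ` with `⟪ψ, Uⁿ ψ⟫ = ∫ e^{inα} dm(α)` for all `n ∈ ℤ`. -/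
def IsSpectralMeasure {H : Type*} [NormedAddCommGroup H] [InnerProductSpace ℂ H]
    (U : H ≃ₗᵢ[ℂ] H) (ψ : H) (m : Measure Torus) : Prop :=
  IsFiniteMeasure m ∧ ∀ n : ℤ, inner ℂ ψ ((U ^ n) ψ) = ∫ α, fourier n α ∂m

/-- The spectrum of `U` is purely absolutely continuous: the spectral measure of every vector is
absolutely continuous with respect to Lebesgue measure. -/
def HasPurelyACSpectrum {H : Type*} [NormedAddCommGroup H] [InnerProductSpace ℂ H]
    (U : H ≃ₗᵢ[ℂ] H) : Prop :=
  ∀ ψ : H, ∃ m : Measure Torus, IsSpectralMeasure U ψ m ∧ m ≪ volume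

end KickedRotor

end

open MeasureTheory

noncomputable section

namespace KickedRotor

open Filter Topology

/-! ### Sums over residue systems -/

theorem sum_range_eq_sum_zmod {E : Type*} [AddCommMonoid E] {q : ℕ} [NeZero q] (H : ZMod q → E) :
    ∑ k ∈ Finset.range q, H k = ∑ x, H x := by
  refine Finset.sum_nbij' (fun k => (k : ZMod q)) ZMod.val ?_ ?_ ?_ ?_ ?_
  · simp
  · intro x _
    simpa using ZMod.val_lt x
  · intro k hk
    exact ZMod.val_cast_of_lt (by simpa using hk)
  · intro x _
    simp
  · simp

theorem exists_zmod_lift {E : Type*} {q : ℕ} [NeZero q] {h : ℤ → E}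
    (hh : Function.Periodic h (q : ℤ)) : ∃ H : ZMod q → E, ∀ n : ℤ, h n = H n := by
  refine ⟨fun x => h (x.val : ℤ), fun n => ?_⟩
  simp only [ZMod.val_intCast]
  conv_lhs => rw [← Int.emod_add_mul_ediv n q, mul_comm]
  exact hh.int_mul _ _

theorem sum_range_periodic_add {E : Type*} [AddCommMonoid E] {q : ℕ} [NeZero q] {h : ℤ → E}
    (hh : Function.Periodic h (q : ℤ)) (t : ℤ) :
    ∑ k ∈ Finset.range q, h (k + t) = ∑ k ∈ Finset.range q, h k := by
  obtain ⟨H, hH⟩ := exists_zmod_lift hh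
  simp only [hH, Int.cast_add, Int.cast_natCast]
  rw [sum_range_eq_sum_zmod (fun x : ZMod q => H (x + t)), sum_range_eq_sum_zmod H]
  exact Fintype.sum_equiv (Equiv.addRight (t : ZMod q)) _ _ fun x => rfl

theorem sum_range_periodic_sub {E : Type*} [AddCommMonoid E] {q : ℕ} [NeZero q] {h : ℤ → E}
    (hh : Function.Periodic h (q : ℤ)) (t : ℤ) :
    ∑ k ∈ Finset.range q, h (t - k) = ∑ k ∈ Finset.range q, h k := by
  obtain ⟨H, hH⟩ := exists_zmod_lift hh
  simp only [hH, Int.cast_sub, Int.cast_natCast]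
  rw [sum_range_eq_sum_zmod (fun x : ZMod q => H (t - x)), sum_range_eq_sum_zmod H]
  exact Fintype.sum_equiv (Equiv.subLeft (t : ZMod q)) _ _ fun x => rfl

/-! ### The free evolution as a Gauss sum -/

/-- The eigenvalue `e^{-iπp(n+β)²/q}` of the free rotation at momentum `n`. -/
def freePhase (p : ℤ) (q : ℕ) (β : ℝ) (n : ℤ) : ℂ :=
  Complex.exp (-Complex.I * Real.pi * p * ((n : ℂ) + β) ^ 2 / q)

/-- The discrete Fourier coefficients of the free eigenvalues. -/
def hopping (p : ℤ) (q : ℕ) (β : ℝ) (l : ℤ) : ℂ :=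
  (1 / (q : ℂ)) * ∑ s ∈ Finset.range q,
    Complex.exp (2 * Real.pi * Complex.I * s * l / q) * freePhase p q β s

theorem freePhase_natCast (p : ℤ) (q : ℕ) (β : ℝ) (s : ℕ) :
    freePhase p q β s = freeEigenvalue p q β s := by
  simp [freePhase, freeEigenvalue]

theorem freeMatrix_apply (p : ℤ) (q : ℕ) (β : ℝ) (j k : Fin q) :
    freeMatrix q p q β j k = hopping p q β ((j : ℤ) - (k : ℤ)) := by
  simp only [freeMatrix, hopping, Matrix.of_apply, freePhase_natCast]
  push_cast
  rfl

theorem exp_two_pi_I_int (n : ℤ) : Complex.exp (2 * Real.pi * Complex.I * n) = 1 := by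
  rw [mul_comm]
  exact Complex.exp_int_mul_two_pi_mul_I n

theorem exp_char_periodic {q : ℕ} [NeZero q] (l : ℤ) :
    Function.Periodic (fun s : ℤ => Complex.exp (2 * Real.pi * Complex.I * s * l / q)) q := by
  intro s
  have hq : (q : ℂ) ≠ 0 := NeZero.ne _
  have : 2 * Real.pi * Complex.I * ((s + q : ℤ) : ℂ) * l / q
      = 2 * Real.pi * Complex.I * s * l / q + 2 * Real.pi * Complex.I * l := by
    push_cast
    field_simp
  simp only [this, Complex.exp_add, exp_two_pi_I_int, mul_one]

theorem hopping_periodic (p : ℤ) (q : ℕ) [NeZero q] (β : ℝ) :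
    Function.Periodic (hopping p q β) q := by
  intro l
  unfold hopping
  congr 1
  refine Finset.sum_congr rfl fun s _ => ?_
  congr 1
  have := exp_char_periodic (q := q) s l
  simp only [Int.cast_natCast] at this
  rw [mul_right_comm _ (s : ℂ), mul_right_comm _ (s : ℂ)]
  exact this

theorem hopping_shift {p : ℤ} {q : ℕ} [NeZero q] {β : ℝ}
    (ha : Function.Periodic (freePhase p q β) q) (l t : ℤ) :
    hopping p q β l = Complex.exp (2 * Real.pi * Complex.I * t * l / q) *
      Complex.exp (-Complex.I * Real.pi * p * (t ^ 2 + 2 * t * β) / q) *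
        hopping p q β (l - p * t) := by
  have hper : Function.Periodic (fun s : ℤ =>
      Complex.exp (2 * Real.pi * Complex.I * s * l / q) * freePhase p q β s) q := by
    intro s
    have h1 := exp_char_periodic (q := q) l s
    simp only at h1 ⊢
    rw [h1, ha s]
  have h := sum_range_periodic_add hper t
  simp only [Int.cast_natCast] at h
  unfold hopping
  rw [← h, mul_left_comm]
  congr 1
  rw [Finset.mul_sum]
  refine Finset.sum_congr rfl fun s _ => ?_
  unfold freePhase
  rw [← Complex.exp_add, ← Complex.exp_add, ← Complex.exp_add, ← Complex.exp_add]
  congr 1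
  push_cast
  ring

theorem sum_char {q : ℕ} [NeZero q] (n : ℤ) :
    ∑ l ∈ Finset.range q, Complex.exp (2 * Real.pi * Complex.I * l * n / q)
      = if (n : ZMod q) = 0 then (q : ℂ) else 0 := by
  have hq : (q : ℂ) ≠ 0 := NeZero.ne _
  have hpow : ∀ l : ℕ, Complex.exp (2 * Real.pi * Complex.I * l * n / q)
      = Complex.exp (2 * Real.pi * Complex.I * n / q) ^ l := by
    intro l
    rw [← Complex.exp_nat_mul]
    congr 1
    ring
  simp only [hpow]
  split_ifs with h
  · rw [ZMod.intCast_zmod_eq_zero_iff_dvd] at h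
    obtain ⟨c, rfl⟩ := h
    have : Complex.exp (2 * Real.pi * Complex.I * ((q * c : ℤ) : ℂ) / q) = 1 := by
      rw [← exp_two_pi_I_int c]
      congr 1
      push_cast
      field_simp
    rw [this]
    simp
  · have hne : Complex.exp (2 * Real.pi * Complex.I * n / q) ≠ 1 := by
      intro h1
      rw [Complex.exp_eq_one_iff] at h1
      obtain ⟨c, hc⟩ := h1
      apply h
      rw [ZMod.intCast_zmod_eq_zero_iff_dvd]
      refine ⟨c, ?_⟩
      have hpi := Complex.two_pi_I_ne_zero
      have h2 : (n : ℂ) = q * c := by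
        field_simp at hc
        have : (2 * Real.pi * Complex.I) * (n : ℂ) = (2 * Real.pi * Complex.I) * (q * c) := by
          linear_combination (2 * Real.pi * Complex.I) * hc
        exact mul_left_cancel₀ hpi this
      exact_mod_cast h2
    rw [geom_sum_eq hne, ← hpow]
    have : Complex.exp (2 * Real.pi * Complex.I * (q : ℂ) * n / q) = 1 := by
      rw [← exp_two_pi_I_int n]
      congr 1
      field_simp
    rw [this]
    simp

/-- Fourier inversion for the free eigenvalues. -/
theorem sum_hopping_mul_exp {p : ℤ} {q : ℕ} [NeZero q] {β : ℝ}
    (ha : Function.Periodic (freePhase p q β) q) (n : ℤ) :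
    ∑ l ∈ Finset.range q, hopping p q β l * Complex.exp (-(2 * Real.pi * Complex.I * l * n / q))
      = freePhase p q β n := by
  have hq : (q : ℂ) ≠ 0 := NeZero.ne _
  obtain ⟨A, hA⟩ := exists_zmod_lift ha
  have step : ∀ s : ℕ, ∑ l ∈ Finset.range q,
      Complex.exp (2 * Real.pi * Complex.I * s * (l : ℤ) / q) *
        Complex.exp (-(2 * Real.pi * Complex.I * l * n / q))
      = if ((s : ZMod q)) = n then (q : ℂ) else 0 := by
    intro s
    have := sum_char (q := q) (s - n)
    simp only [Int.cast_sub, Int.cast_natCast, sub_eq_zero] at this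
    rw [← this]
    refine Finset.sum_congr rfl fun l _ => ?_
    rw [← Complex.exp_add]
    congr 1
    push_cast
    ring
  calc _ = (1 / (q : ℂ)) * ∑ s ∈ Finset.range q, freePhase p q β s * ∑ l ∈ Finset.range q,
      Complex.exp (2 * Real.pi * Complex.I * s * (l : ℤ) / q) *
        Complex.exp (-(2 * Real.pi * Complex.I * l * n / q)) := by
        simp only [hopping, Finset.mul_sum, Finset.sum_mul]
        rw [Finset.sum_comm]
        refine Finset.sum_congr rfl fun s _ => Finset.sum_congr rfl fun l _ => ?_
        ring
    _ = _ := by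
        simp_rw [step, hA, Int.cast_natCast]
        rw [sum_range_eq_sum_zmod (fun x : ZMod q => A x * if x = n then (q : ℂ) else 0)]
        simp
        field_simp

theorem freePhase_ne_zero (p : ℤ) (q : ℕ) (β : ℝ) (n : ℤ) : freePhase p q β n ≠ 0 :=
  Complex.exp_ne_zero _

/-- At a primitive resonance the matrix of the free evolution is, up to diagonal factors,
the Fourier matrix of a primitive root of unity. -/
theorem exists_hopping_sub_eq {p : ℤ} {q : ℕ} [NeZero q] {β : ℝ} (hpq : IsCoprime p (q : ℤ))
    (ha : Function.Periodic (freePhase p q β) q) :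
    ∃ (u v : ℤ → ℂ) (ζ : ℂ), (∀ j, u j ≠ 0) ∧ (∀ k, v k ≠ 0) ∧ IsPrimitiveRoot ζ q ∧
      ∀ j k : ℕ, hopping p q β (j - k) = u j * v k * (ζ ^ k) ^ j := by
  have hq : (q : ℂ) ≠ 0 := NeZero.ne _
  obtain ⟨r, c, hrc⟩ := hpq
  have hc : (p : ℂ) * r = 1 - q * c := by
    have : (r : ℂ) * p + c * q = 1 := by exact_mod_cast hrc
    linear_combination this
  set C : ℂ := hopping p q β 0
  have key : ∀ l : ℤ, hopping p q β l = Complex.exp (2 * Real.pi * Complex.I * (r * l) * l / q) *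
      Complex.exp (-Complex.I * Real.pi * p * ((r * l) ^ 2 + 2 * (r * l) * β) / q) * C := by
    intro l
    rw [hopping_shift ha l (r * l)]
    have : l - p * (r * l) = 0 + (c * l) * (q : ℤ) := by linear_combination (-l) * hrc
    rw [this]
    have h2 : hopping p q β (0 + c * l * q) = C := by
      have := (hopping_periodic p q β).int_mul (c * l) 0
      simpa using this
    rw [h2]
    push_cast
    rfl
  have hC : C ≠ 0 := by
    intro h0
    have := sum_hopping_mul_exp ha 0
    simp only [key, h0, mul_zero, zero_mul, Finset.sum_const_zero] at this
    exact freePhase_ne_zero p q β 0 this.symm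
  set Q : ℂ := Complex.I * Real.pi * (2 * r - p * r ^ 2) / q
  set Λ : ℂ := -Complex.I * Real.pi * p * 2 * r * β / q
  set ζ₀ : ℂ := Complex.exp (2 * Real.pi * Complex.I / q)
  have hζ₀ : IsPrimitiveRoot ζ₀ q := Complex.isPrimitiveRoot_exp q (NeZero.ne q)
  have hprim : IsPrimitiveRoot (ζ₀ ^ (-r)) q := by
    have : IsCoprime r (q : ℤ) := ⟨p, c, by linear_combination hrc⟩
    refine hζ₀.zpow_of_gcd_eq_one (-r) ?_
    rw [Int.neg_gcd]
    exact Int.isCoprime_iff_gcd_eq_one.1 this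
  have hζ : ζ₀ ^ (-r) = Complex.exp (-2 * Q) := by
    rw [← Complex.exp_int_mul]
    have : -2 * Q = ((-r : ℤ) : ℂ) * (2 * Real.pi * Complex.I / q)
        + 2 * Real.pi * Complex.I * ((-(r * c) : ℤ) : ℂ) := by
      simp only [Q]
      push_cast
      field_simp
      linear_combination (r : ℂ) * hc
    rw [this, Complex.exp_add, exp_two_pi_I_int, mul_one]
  refine ⟨fun j => C * Complex.exp (Q * j ^ 2 + Λ * j), fun k => Complex.exp (Q * k ^ 2 - Λ * k),
    ζ₀ ^ (-r), fun j => mul_ne_zero hC (Complex.exp_ne_zero _), fun k => Complex.exp_ne_zero _,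
    hprim, fun j k => ?_⟩
  rw [key, hζ, ← pow_mul, ← Complex.exp_nat_mul, ← Complex.exp_add, mul_comm _ C, mul_assoc C,
    mul_assoc C, ← Complex.exp_add, ← Complex.exp_add]
  congr 2
  simp only [Q, Λ]
  push_cast
  field_simp
  ring

/-! ### Absence of flat bands -/

/-- The Bloch matrix at a complex quasi-position. -/
def complexBloch (p : ℤ) (q : ℕ) (β μ : ℝ) (z : ℂ) : Matrix (Fin q) (Fin q) ℂ :=
  Matrix.of fun j k => Complex.exp (-Complex.I * μ * Complex.cos (z + 2 * Real.pi * (j : ℕ) / q)) *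
    freeMatrix q p q β j k

theorem blochMatrix_eq_complexBloch (p : ℤ) (q : ℕ) (β x μ : ℝ) :
    blochMatrix q p q β x μ = complexBloch p q β μ x := by
  ext j k
  simp [blochMatrix, complexBloch]

theorem sum_fin_eq_sum_castLE {E : Type*} [AddCommMonoid E] {m q : ℕ} (h : m ≤ q) {F : Fin q → E}
    (hF : ∀ k : Fin q, m ≤ (k : ℕ) → F k = 0) : ∑ k, F k = ∑ k : Fin m, F (Fin.castLE h k) := by
  refine (Eq.trans ?_ (Finset.sum_map Finset.univ (Fin.castLEEmb h) F)).trans rfl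
  symm
  refine Finset.sum_subset (Finset.subset_univ _) fun k _ hk => hF k ?_
  by_contra hlt
  exact hk (Finset.mem_map.2 ⟨⟨k, not_le.1 hlt⟩, Finset.mem_univ _, rfl⟩)

/-- The leading principal minors of the free matrix do not vanish at a primitive resonance. -/
theorem eq_zero_of_leading_block {p : ℤ} {q : ℕ} [NeZero q] {β : ℝ} (hpq : IsCoprime p (q : ℤ))
    (ha : Function.Periodic (freePhase p q β) q) {m : ℕ} (hm : m ≤ q) {y : Fin q → ℂ}
    (hy : ∀ k : Fin q, m ≤ (k : ℕ) → y k = 0)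
    (hG : ∀ j : Fin q, (j : ℕ) < m → ∑ k, freeMatrix q p q β j k * y k = 0) : y = 0 := by
  obtain ⟨u, v, ζ, hu, hv, hζ, h⟩ := exists_hopping_sub_eq hpq ha
  have hinj : Function.Injective fun k : Fin m => ζ ^ (k : ℕ) := by
    intro a b hab
    exact Fin.ext (hζ.pow_inj (a.2.trans_le hm) (b.2.trans_le hm) hab)
  have hz : (fun k : Fin m => v (k : ℕ) * y (Fin.castLE hm k)) = 0 := by
    refine Matrix.eq_zero_of_forall_pow_sum_mul_pow_eq_zero hinj fun j => ?_
    have h1 := hG (Fin.castLE hm j) j.2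
    rw [sum_fin_eq_sum_castLE hm fun k hk => by rw [hy k hk, mul_zero]] at h1
    simp only [freeMatrix_apply, Fin.val_castLE, h] at h1
    refine (mul_eq_zero.1 (?_ : u (j : ℕ) * _ = 0)).resolve_left (hu _)
    rw [Finset.mul_sum, ← h1]
    exact Finset.sum_congr rfl fun k _ => by ring
  funext k
  by_cases hk : m ≤ (k : ℕ)
  · exact hy k hk
  · have := congrFun hz ⟨k, not_le.1 hk⟩
    exact (mul_eq_zero.1 this).resolve_left (hv _)

theorem norm_exp_kick (x s t μ : ℝ) (hμ : μ ≠ 0) (hs : s = Real.arsinh (-t / μ)) :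
    ‖Complex.exp (-Complex.I * μ * Complex.cos (x + s * Complex.I))‖
      = Real.exp (t * Real.sin x) := by
  rw [Complex.norm_exp]
  congr 1
  have h1 : (Complex.cos (x + s * Complex.I)).im = -(Real.sin x * Real.sinh s) := by
    rw [Complex.cos_add_mul_I]
    simp [Complex.sin_ofReal_re, Complex.sinh_ofReal_re]
  have h2 : (-Complex.I * μ * Complex.cos (x + s * Complex.I)).re
      = μ * (Complex.cos (x + s * Complex.I)).im := by
    simp
  rw [h2, h1, hs, Real.sinh_arsinh]
  field_simp

/-- No number `w ≠ 0` is an eigenvalue of the Bloch matrix at all complex quasi-positions. -/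
theorem exists_det_complexBloch_ne_zero {p : ℤ} {q : ℕ} [NeZero q] {β μ : ℝ}
    (hpq : IsCoprime p (q : ℤ)) (ha : Function.Periodic (freePhase p q β) q) (hμ : μ ≠ 0)
    {w : ℂ} (hw : w ≠ 0) : ∃ z, (complexBloch p q β μ z - w • 1).det ≠ 0 := by
  by_contra! hdet
  have hq : (0 : ℝ) < q := by exact_mod_cast NeZero.pos q
  set m : ℕ := (q + 1) / 2
  have hm : m ≤ q := by have := NeZero.pos q; omega
  set x : Fin q → ℝ := fun j => Real.pi * (4 * (j : ℕ) + 1) / (2 * q)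
  have hpos : ∀ j : Fin q, (j : ℕ) < m → 0 < Real.sin (x j) := by
    intro j hj
    refine Real.sin_pos_of_pos_of_lt_pi (by positivity) ?_
    have h1 : 4 * (j : ℕ) + 1 < 2 * q := by omega
    have h2 : (4 * (j : ℕ) + 1 : ℝ) < 2 * q := by exact_mod_cast h1
    rw [div_lt_iff₀ (by positivity)]
    exact mul_lt_mul_of_pos_left h2 Real.pi_pos
  have hneg : ∀ j : Fin q, m ≤ (j : ℕ) → Real.sin (x j) < 0 := by
    intro j hj
    have h1 : 2 * q < 4 * (j : ℕ) + 1 := by omega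
    have h2 : (2 * q : ℝ) < 4 * (j : ℕ) + 1 := by exact_mod_cast h1
    have h3 : 4 * (j : ℕ) + 1 < 4 * q := by have := j.2; omega
    have h4 : (4 * (j : ℕ) + 1 : ℝ) < 4 * q := by exact_mod_cast h3
    have h5 : Real.pi < x j := by
      rw [lt_div_iff₀ (by positivity)]
      exact mul_lt_mul_of_pos_left h2 Real.pi_pos
    have h6 : x j < 2 * Real.pi := by
      rw [div_lt_iff₀ (by positivity)]
      have := mul_lt_mul_of_pos_left h4 Real.pi_pos
      linarith
    have h7 : 0 < Real.sin (x j - Real.pi) :=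
      Real.sin_pos_of_pos_of_lt_pi (by linarith) (by linarith)
    rw [Real.sin_sub_pi] at h7
    linarith
  set z : ℝ → ℂ := fun t => (Real.pi / (2 * q) : ℝ) + (Real.arsinh (-t / μ) : ℝ) * Complex.I
  set d : ℝ → Fin q → ℂ := fun t j =>
    Complex.exp (-Complex.I * μ * Complex.cos (z t + 2 * Real.pi * (j : ℕ) / q))
  have hd : ∀ t j, ‖d t j‖ = Real.exp (t * Real.sin (x j)) := by
    intro t j
    rw [← norm_exp_kick (x j) _ t μ hμ rfl]
    have : z t + 2 * Real.pi * (j : ℕ) / q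
        = (x j : ℂ) + (Real.arsinh (-t / μ) : ℝ) * Complex.I := by
      have hq' : (q : ℂ) ≠ 0 := NeZero.ne _
      simp only [z, x]
      push_cast
      field_simp
      ring
    simp only [d, this]
  have hd0 : ∀ t j, d t j ≠ 0 := fun t j => Complex.exp_ne_zero _
  set G := freeMatrix q p q β
  set N : ℝ → Matrix (Fin q) (Fin q) ℂ := fun t => Matrix.of fun j k =>
    if (j : ℕ) < m then G j k - (d t j)⁻¹ * (w • (1 : Matrix (Fin q) (Fin q) ℂ)) j k
    else d t j * G j k - (w • (1 : Matrix (Fin q) (Fin q) ℂ)) j k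
  set N' : Matrix (Fin q) (Fin q) ℂ := Matrix.of fun j k =>
    if (j : ℕ) < m then G j k else -(w • (1 : Matrix (Fin q) (Fin q) ℂ)) j k
  have hN : ∀ t, (N t).det = 0 := by
    intro t
    have : N t = Matrix.diagonal (fun j : Fin q => if (j : ℕ) < m then (d t j)⁻¹ else 1) *
        (complexBloch p q β μ (z t) - w • 1) := by
      ext j k
      have h1 : complexBloch p q β μ (z t) j k = d t j * G j k := rfl
      rw [Matrix.diagonal_mul, Matrix.sub_apply, h1]
      simp only [N, Matrix.of_apply]
      split_ifs
      · rw [mul_sub, inv_mul_cancel_left₀ (hd0 t j)]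
      · rw [one_mul]
    rw [this, Matrix.det_mul, hdet, mul_zero]
  have hlim : Tendsto N atTop (𝓝 N') := by
    refine tendsto_pi_nhds.2 fun j => tendsto_pi_nhds.2 fun k => ?_
    simp only [N, N', Matrix.of_apply]
    split_ifs with hj
    · have : Tendsto (fun t => (d t j)⁻¹) atTop (𝓝 0) := by
        rw [tendsto_zero_iff_norm_tendsto_zero]
        simp only [norm_inv, hd, ← Real.exp_neg]
        refine Real.tendsto_exp_atBot.comp (tendsto_neg_atTop_atBot.comp ?_)
        exact tendsto_id.atTop_mul_const (hpos j hj)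
      simpa using (tendsto_const_nhds (x := G j k)).sub
        (this.mul_const ((w • (1 : Matrix (Fin q) (Fin q) ℂ)) j k))
    · have : Tendsto (fun t => d t j) atTop (𝓝 0) := by
        rw [tendsto_zero_iff_norm_tendsto_zero]
        simp only [hd]
        refine Real.tendsto_exp_atBot.comp ?_
        exact tendsto_id.atTop_mul_const_of_neg (hneg j (not_lt.1 hj))
      simpa using (this.mul_const (G j k)).sub
        (tendsto_const_nhds (x := (w • (1 : Matrix (Fin q) (Fin q) ℂ)) j k))
  have hdet' : N'.det = 0 := by
    have h1 : Tendsto (fun t => (N t).det) atTop (𝓝 N'.det) :=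
      ((continuous_id.matrix_det).tendsto N').comp hlim
    simp only [hN] at h1
    exact tendsto_nhds_unique h1 tendsto_const_nhds |>.symm ▸ rfl
  obtain ⟨y, hy0, hy⟩ := Matrix.exists_mulVec_eq_zero_iff.2 hdet'
  refine hy0 (eq_zero_of_leading_block hpq ha hm (fun k hk => ?_) fun j hj => ?_)
  · have := congrFun hy k
    simp only [Matrix.mulVec, dotProduct, N', Matrix.of_apply, not_lt.2 hk, if_false] at this
    simpa [Matrix.one_apply, hw] using this
  · have := congrFun hy j
    simpa only [Matrix.mulVec, dotProduct, N', Matrix.of_apply, hj, if_true, Pi.zero_apply] using this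

theorem analyticOnNhd_det_complexBloch (p : ℤ) (q : ℕ) (β μ : ℝ) (w : ℂ) :
    AnalyticOnNhd ℂ (fun z => (complexBloch p q β μ z - w • 1).det) Set.univ := by
  rw [Complex.analyticOnNhd_univ_iff_differentiable]
  simp only [Matrix.det_apply, Matrix.sub_apply, complexBloch, Matrix.of_apply]
  fun_prop

/-- No number `w ≠ 0` is an eigenvalue of the Bloch matrix on an interval of quasi-positions. -/
theorem exists_det_blochMatrix_ne_zero {p : ℤ} {q : ℕ} [NeZero q] {β μ : ℝ}
    (hpq : IsCoprime p (q : ℤ)) (ha : Function.Periodic (freePhase p q β) q) (hμ : μ ≠ 0)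
    {w : ℂ} (hw : w ≠ 0) (x₀ : ℝ) :
    ∃ᶠ x in 𝓝 x₀, (blochMatrix q p q β x μ - w • 1).det ≠ 0 := by
  obtain ⟨z, hz⟩ := exists_det_complexBloch_ne_zero hpq ha hμ hw
  intro h
  refine hz ?_
  have h2 : ∀ᶠ x : ℝ in 𝓝[≠] x₀, (complexBloch p q β μ (x : ℂ) - w • 1).det = 0 := by
    filter_upwards [h.filter_mono nhdsWithin_le_nhds] with x hx
    rw [not_ne_iff, blochMatrix_eq_complexBloch] at hx
    exact hx
  have h3 : Tendsto (fun x : ℝ => (x : ℂ)) (𝓝[≠] x₀) (𝓝[≠] (x₀ : ℂ)) := by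
    refine tendsto_nhdsWithin_iff.2 ⟨?_, ?_⟩
    · exact (Complex.continuous_ofReal.tendsto x₀).mono_left nhdsWithin_le_nhds
    · filter_upwards [self_mem_nhdsWithin] with x hx
      simpa using hx
  exact (analyticOnNhd_det_complexBloch p q β μ w).eqOn_zero_of_preconnected_of_frequently_eq_zero
    isPreconnected_univ (Set.mem_univ (x₀ : ℂ)) (h3.frequently h2.frequently) (Set.mem_univ z)

/-! ### Unitarity of the Bloch matrix -/

/-- The Fourier matrix of order `q`. -/
def fourierMatrix (q : ℕ) : Matrix (Fin q) (Fin q) ℂ :=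
  Matrix.of fun j s => Complex.exp (2 * Real.pi * Complex.I * (s : ℕ) * ((j : ℕ) : ℤ) / q)

theorem star_exp_char (q : ℕ) (a b : ℂ) (ha : star a = a) (hb : star b = b) :
    star (Complex.exp (2 * Real.pi * Complex.I * a * b / q))
      = Complex.exp (-(2 * Real.pi * Complex.I * a * b / q)) := by
  rw [Complex.star_def, ← Complex.exp_conj]
  congr 1
  rw [Complex.star_def] at ha hb
  simp [ha, hb, Complex.conj_ofNat]
  ring

theorem fourierMatrix_mul_conjTranspose (q : ℕ) [NeZero q] :
    fourierMatrix q * (fourierMatrix q).conjTranspose = (q : ℂ) • 1 := by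
  ext j k
  rw [Matrix.mul_apply]
  simp only [fourierMatrix, Matrix.conjTranspose_apply, Matrix.of_apply]
  have h := sum_char (q := q) ((j : ℕ) - (k : ℕ) : ℤ)
  rw [← Fin.sum_univ_eq_sum_range
    (fun l => Complex.exp (2 * Real.pi * Complex.I * l * (((j : ℕ) - (k : ℕ) : ℤ) : ℂ) / q))] at h
  have h2 : (((j : ℕ) - (k : ℕ) : ℤ) : ZMod q) = 0 ↔ j = k := by
    rw [Int.cast_sub, sub_eq_zero, Int.cast_natCast, Int.cast_natCast,
      ZMod.natCast_eq_natCast_iff', Nat.mod_eq_of_lt j.2, Nat.mod_eq_of_lt k.2, Fin.ext_iff]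
  simp only [h2] at h
  rw [Matrix.smul_apply, Matrix.one_apply, smul_eq_mul, mul_ite, mul_one, mul_zero, ← h]
  refine Finset.sum_congr rfl fun s _ => ?_
  rw [star_exp_char _ _ _ (by simp) (by simp), ← Complex.exp_add]
  congr 1
  push_cast
  ring

theorem freeMatrix_eq (p : ℤ) (q : ℕ) (β : ℝ) :
    freeMatrix q p q β = (1 / (q : ℂ)) • (fourierMatrix q *
      Matrix.diagonal (fun s : Fin q => freePhase p q β s) *
        (fourierMatrix q).conjTranspose) := by
  ext j k
  rw [freeMatrix_apply, hopping, Matrix.smul_apply, smul_eq_mul, Matrix.mul_apply,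
    ← Fin.sum_univ_eq_sum_range (fun s => Complex.exp (2 * Real.pi * Complex.I * s *
      (((j : ℤ) - (k : ℤ) : ℤ) : ℂ) / q) * freePhase p q β s)]
  congr 1
  refine Finset.sum_congr rfl fun s _ => ?_
  rw [Matrix.mul_diagonal, Matrix.conjTranspose_apply]
  simp only [fourierMatrix, Matrix.of_apply]
  rw [star_exp_char _ _ _ (by simp) (by simp), mul_right_comm (Complex.exp _), ← Complex.exp_add]
  congr 2
  push_cast
  ring

theorem star_freePhase_mul (p : ℤ) (q : ℕ) (β : ℝ) (n : ℤ) :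
    freePhase p q β n * star (freePhase p q β n) = 1 := by
  rw [freePhase, Complex.star_def, ← Complex.exp_conj, ← Complex.exp_add, ← Complex.exp_zero]
  congr 1
  simp
  ring

theorem freeMatrix_mem_unitary (p : ℤ) (q : ℕ) [NeZero q] (β : ℝ) :
    freeMatrix q p q β ∈ Matrix.unitaryGroup (Fin q) ℂ := by
  have hq : (q : ℂ) ≠ 0 := NeZero.ne _
  rw [Matrix.mem_unitaryGroup_iff, freeMatrix_eq, Matrix.star_eq_conjTranspose,
    Matrix.conjTranspose_smul, Matrix.conjTranspose_mul, Matrix.conjTranspose_mul,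
    Matrix.conjTranspose_conjTranspose, Matrix.diagonal_conjTranspose]
  have h1 := fourierMatrix_mul_conjTranspose q
  have h2 : (fourierMatrix q).conjTranspose * fourierMatrix q = (q : ℂ) • 1 := by
    have h3 : fourierMatrix q * ((1 / (q : ℂ)) • (fourierMatrix q).conjTranspose) = 1 := by
      rw [Matrix.mul_smul, h1, smul_smul, one_div, inv_mul_cancel₀ hq, one_smul]
    have h4 := mul_eq_one_comm.1 h3
    rw [Matrix.smul_mul] at h4
    rw [← h4, smul_smul, one_div, mul_inv_cancel₀ hq, one_smul]
  set F := fourierMatrix q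
  set A := Matrix.diagonal (fun s : Fin q => freePhase p q β s)
  set B := Matrix.diagonal (star fun s : Fin q => freePhase p q β s)
  have hAB : A * B = 1 := by
    rw [Matrix.diagonal_mul_diagonal, ← Matrix.diagonal_one]
    congr 1
    funext s
    exact star_freePhase_mul p q β s
  rw [Matrix.smul_mul, Matrix.mul_smul, smul_smul]
  have : F * A * F.conjTranspose * (F * (B * F.conjTranspose))
      = F * A * (F.conjTranspose * F) * (B * F.conjTranspose) := by
    simp only [Matrix.mul_assoc]
  rw [this, h2, Matrix.mul_smul, Matrix.mul_one, Matrix.smul_mul, Matrix.mul_assoc,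
    ← Matrix.mul_assoc A, hAB, Matrix.one_mul, h1, smul_smul, smul_smul]
  have : 1 / (q : ℂ) * star (1 / (q : ℂ)) * q * q = 1 := by
    simp
    field_simp
  rw [this, one_smul]

theorem diagonal_mem_unitary {n : Type*} [Fintype n] [DecidableEq n] (d : n → Circle) :
    Matrix.diagonal (fun j => (d j : ℂ)) ∈ Matrix.unitaryGroup n ℂ := by
  rw [Matrix.mem_unitaryGroup_iff, Matrix.star_eq_conjTranspose, Matrix.diagonal_conjTranspose,
    Matrix.diagonal_mul_diagonal, ← Matrix.diagonal_one]
  congr 1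
  funext j
  simp [Complex.mul_conj, Circle.normSq_coe]

/-- The kick `e^{-iμ cos θ}` as a function. -/
def kickFun (μ : ℝ) : C(Torus, Circle) := ⟨fun θ => Circle.exp (-(μ * cosTorus θ)), by fun_prop⟩

theorem kickFun_coe (μ x : ℝ) :
    (kickFun μ (x : Torus) : ℂ) = Complex.exp (-Complex.I * μ * Real.cos x) := by
  have : cosTorus (x : Torus) = Real.cos x := rfl
  simp only [kickFun, ContinuousMap.coe_mk, Circle.coe_exp, this]
  congr 1
  push_cast
  ring

/-- The kicks at the points `θ + 2πj/q`. -/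
def kickDiag (q : ℕ) (μ : ℝ) (θ : Torus) : Matrix (Fin q) (Fin q) ℂ :=
  Matrix.diagonal fun j : Fin q => (kickFun μ (θ + ((2 * Real.pi * (j : ℕ) / q : ℝ) : Torus)) : ℂ)

theorem blochMatrix_eq_mul (p : ℤ) (q : ℕ) (β x μ : ℝ) :
    blochMatrix q p q β x μ = kickDiag q μ x * freeMatrix q p q β := by
  ext j k
  rw [kickDiag, Matrix.diagonal_mul, ← AddCircle.coe_add, kickFun_coe]
  rfl

theorem blochMatrix_mem_unitary (p : ℤ) (q : ℕ) [NeZero q] (β x μ : ℝ) :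
    blochMatrix q p q β x μ ∈ Matrix.unitaryGroup (Fin q) ℂ := by
  rw [blochMatrix_eq_mul]
  exact mul_mem (diagonal_mem_unitary _) (freeMatrix_mem_unitary p q β)

open scoped Matrix.Norms.L2Operator in
theorem norm_eq_one_of_charpoly_root {n : Type*} [Fintype n] [DecidableEq n] {M : Matrix n n ℂ}
    (hM : M ∈ Matrix.unitaryGroup n ℂ) {w : ℂ} (hw : M.charpoly.IsRoot w) : ‖w‖ = 1 := by
  rw [← Matrix.mem_spectrum_iff_isRoot_charpoly] at hw
  simpa using spectrum.subset_circle_of_unitary hM hw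

theorem det_sub_smul_eq_zero_of_isRoot {n : Type*} [Fintype n] [DecidableEq n] {M : Matrix n n ℂ}
    {w : ℂ} (hw : M.charpoly.IsRoot w) : (M - w • 1).det = 0 := by
  rw [Polynomial.IsRoot, Matrix.eval_charpoly] at hw
  rw [← neg_sub, Matrix.det_neg, Matrix.smul_one_eq_diagonal]
  exact mul_eq_zero_of_right _ hw

/-! ### Commutation with the momentum translation -/

theorem mulOp_mul (g h : C(Torus, Circle)) : mulOp g * mulOp h = mulOp (g * h) := by
  ext1 f
  apply Lp.ext
  filter_upwards [(memLp_mul g (mulOp h f)).coeFn_toLp, (memLp_mul h f).coeFn_toLp,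
    (memLp_mul (g * h) f).coeFn_toLp] with x h1 h2 h3
  change (memLp_mul g (mulOp h f)).toLp _ x = (memLp_mul (g * h) f).toLp _ x
  rw [h1, h3]
  change (g x : ℂ) * (memLp_mul h f).toLp _ x = _
  rw [h2, ContinuousMap.mul_apply, Circle.coe_mul, mul_assoc]

theorem isometryEquiv_mul_apply {H : Type*} [NormedAddCommGroup H] [InnerProductSpace ℂ H]
    (U V : H ≃ₗᵢ[ℂ] H) (x : H) : (U * V) x = U (V x) := rfl

theorem momentumShift_fourierLp (n : ℤ) :
    momentumShift (fourierLp 2 n) = fourierLp (T := 2 * Real.pi) 2 (n + 1) := by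
  apply Lp.ext
  filter_upwards [(memLp_mul ⟨fun θ => AddCircle.toCircle θ, AddCircle.continuous_toCircle⟩
    (fourierLp 2 n)).coeFn_toLp, coeFn_fourierLp (T := 2 * Real.pi) 2 n,
    coeFn_fourierLp (T := 2 * Real.pi) 2 (n + 1)] with x h1 h2 h3
  rw [h3]
  refine Eq.trans h1 ?_
  rw [h2, add_comm, fourier_add, fourier_one]
  rfl

theorem momentumShift_pow_fourierLp (Q : ℕ) (n : ℤ) :
    (momentumShift ^ Q) (fourierLp 2 n) = fourierLp (T := 2 * Real.pi) 2 (n + Q) := by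
  induction Q with
  | zero => simp
  | succ Q ih =>
    rw [pow_succ', isometryEquiv_mul_apply, ih, momentumShift_fourierLp]
    push_cast
    rw [add_assoc]

theorem freeRotation_fourierLp (β τ : ℝ) (n : ℤ) :
    freeRotation β τ (fourierLp 2 n)
      = (Circle.exp (-(τ / 2 * ((n : ℝ) + β) ^ 2)) : ℂ) • fourierLp (T := 2 * Real.pi) 2 n := by
  rw [← coe_fourierBasis]
  apply (fourierBasis (T := 2 * Real.pi)).repr.injective
  simp only [freeRotation, LinearIsometryEquiv.trans_apply, LinearIsometryEquiv.apply_symm_apply,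
    HilbertBasis.repr_self, map_smul]
  ext k
  change (Circle.exp (-(τ / 2 * ((k : ℝ) + β) ^ 2)) : ℂ) * _ = _ * _
  by_cases hk : k = n
  · subst hk
    rfl
  · simp [lp.single_apply, hk]

theorem freePhase_eq_circle {τ : ℝ} {p : ℤ} {q : ℕ} (β : ℝ) (hτ : τ = 2 * Real.pi * p / q) (n : ℤ) :
    (Circle.exp (-(τ / 2 * ((n : ℝ) + β) ^ 2)) : ℂ) = freePhase p q β n := by
  rw [Circle.coe_exp, freePhase, hτ]
  congr 1
  push_cast
  ring

theorem freePhase_periodic {β τ μ : ℝ} {p : ℤ} {q : ℕ} (hτ : τ = 2 * Real.pi * p / q)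
    (hc : Commute (propagator β τ μ) (momentumShift ^ q)) :
    Function.Periodic (freePhase p q β) q := by
  intro n
  have hk : Commute (kick μ) (momentumShift ^ q) := by
    refine Commute.pow_right ?_ q
    change mulOp _ * mulOp _ = mulOp _ * mulOp _
    rw [mulOp_mul, mulOp_mul]
    exact congrArg mulOp (mul_comm _ _)
  have hR : Commute (freeRotation β τ) (momentumShift ^ q) := by
    have : freeRotation β τ = propagator β τ μ * (kick μ)⁻¹ := by
      rw [propagator, mul_assoc, mul_inv_cancel, mul_one]
    rw [this]
    exact hc.mul_left hk.inv_left
  have h := DFunLike.congr_fun hR.eq (fourierLp 2 n)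
  rw [isometryEquiv_mul_apply, isometryEquiv_mul_apply, momentumShift_pow_fourierLp,
    freeRotation_fourierLp, freeRotation_fourierLp, map_smul, momentumShift_pow_fourierLp,
    freePhase_eq_circle β hτ, freePhase_eq_circle β hτ] at h
  have hne : fourierLp (T := 2 * Real.pi) 2 (n + q) ≠ 0 := orthonormal_fourier.ne_zero _
  exact smul_left_injective ℂ hne h

/-- No band is flat. -/
theorem not_isFlatBand {β μ : ℝ} {p : ℤ} {q : ℕ} [NeZero q] (hpq : IsCoprime p (q : ℤ))
    (ha : Function.Periodic (freePhase p q β) q) (hμ : μ ≠ 0) {w : Fin q → ℝ → ℝ → ℂ}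
    (hw : IsEigenvalueNumbering q p q β w) (j : Fin q) : ¬ IsFlatBand q (fun x => w j x μ) := by
  rintro ⟨α, hα⟩
  have hq : (0 : ℝ) < q := by exact_mod_cast NeZero.pos q
  have hroot : ∀ x ∈ Set.Ioo 0 (2 * Real.pi / q),
      (blochMatrix q p q β x μ).charpoly.IsRoot (w j x μ) := by
    intro x hx
    refine Polynomial.isRoot_of_mem_roots ?_
    rw [hw.1 x hx μ]
    exact Multiset.mem_map_of_mem _ (Finset.mem_univ j)
  have hconst : ∀ x ∈ Set.Ioo 0 (2 * Real.pi / q), w j x μ = Complex.exp (α * Complex.I) := by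
    intro x hx
    have h1 := norm_eq_one_of_charpoly_root (blochMatrix_mem_unitary p q β x μ) (hroot x hx)
    have h2 := Complex.norm_mul_exp_arg_mul_I (w j x μ)
    rw [h1, hα x hx] at h2
    simpa using h2.symm
  have hmid : Real.pi / q ∈ Set.Ioo 0 (2 * Real.pi / q) := by
    constructor
    · positivity
    · have := Real.pi_pos
      gcongr
      linarith
  refine exists_det_blochMatrix_ne_zero hpq ha hμ (Complex.exp_ne_zero (α * Complex.I))
    (Real.pi / q) ?_
  filter_upwards [isOpen_Ioo.mem_nhds hmid] with x hx
  rw [not_ne_iff, ← hconst x hx]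
  exact det_sub_smul_eq_zero_of_isRoot (hroot x hx)

open scoped ContDiff

/-! ### Zero sets of smooth functions of two variables -/

/-- The partial derivative with respect to the first variable. -/
def partialFst (F : ℝ × ℝ → ℂ) (z : ℝ × ℝ) : ℂ := fderiv ℝ F z (1, 0)

theorem contDiff_partialFst {F : ℝ × ℝ → ℂ} (hF : ContDiff ℝ ∞ F) : ContDiff ℝ ∞ (partialFst F) :=
  (hF.fderiv_right (m := ∞) (by simp)).clm_apply contDiff_const

theorem contDiff_iterate_partialFst {F : ℝ × ℝ → ℂ} (hF : ContDiff ℝ ∞ F) (n : ℕ) :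
    ContDiff ℝ ∞ (partialFst^[n] F) := by
  induction n with
  | zero => exact hF
  | succ n ih =>
    rw [Function.iterate_succ_apply']
    exact contDiff_partialFst ih

theorem iteratedDeriv_eq_iterate_partialFst {F : ℝ × ℝ → ℂ} (hF : ContDiff ℝ ∞ F) (n : ℕ)
    (a x : ℝ) : iteratedDeriv n (fun x => F (x, a)) x = partialFst^[n] F (x, a) := by
  induction n generalizing x with
  | zero => rfl
  | succ n ih =>
    have h1 : iteratedDeriv n (fun x => F (x, a)) = fun x => partialFst^[n] F (x, a) := funext ih
    rw [iteratedDeriv_succ, h1, Function.iterate_succ_apply']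
    have h2 : HasFDerivAt (partialFst^[n] F) (fderiv ℝ (partialFst^[n] F) (x, a)) (x, a) :=
      ((contDiff_iterate_partialFst hF n).differentiable (by simp) _).hasFDerivAt
    have h3 : HasDerivAt (fun x : ℝ => (x, a)) ((1 : ℝ), (0 : ℝ)) x :=
      (hasDerivAt_id x).prodMk (hasDerivAt_const x a)
    exact (h2.comp_hasDerivAt x h3).deriv

theorem volume_eq_zero_of_antilipschitz {N E : Set ℝ} (hN : volume N = 0) {K : NNReal}
    {f : E → ℝ} (hf : AntilipschitzWith K f) (hmem : ∀ x, f x ∈ N) : volume E = 0 := by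
  rw [← hausdorffMeasure_real] at hN ⊢
  have h1 : Measure.hausdorffMeasure 1 (Set.univ : Set E) = 0 := by
    refine le_antisymm ((hf.le_hausdorffMeasure_image zero_le_one Set.univ).trans ?_) zero_le
    have : f '' Set.univ ⊆ N := by
      rintro _ ⟨x, -, rfl⟩
      exact hmem x
    rw [measure_mono_null this hN, mul_zero]
  have h2 := (isometry_subtype_coe (s := E)).hausdorffMeasure_image (d := 1) (Or.inl zero_le_one)
    Set.univ
  rw [Set.image_univ, Subtype.range_coe, h1] at h2
  exact h2

/-- Where the partial derivative in the first variable does not vanish, the first coordinate of a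
zero is locally a Lipschitz function of the second one. -/
theorem exists_nhds_volume_zero_set_eq_zero {F : ℝ × ℝ → ℂ} (hF : ContDiff ℝ ∞ F) {z₀ : ℝ × ℝ}
    (hz₀ : partialFst F z₀ ≠ 0) {N : Set ℝ} (hN : volume N = 0) :
    ∃ U ∈ 𝓝 z₀, volume {x : ℝ | ∃ a ∈ N, (x, a) ∈ U ∧ F (x, a) = 0} = 0 := by
  set F' := fderiv ℝ F z₀
  have hstrict : HasStrictFDerivAt F F' z₀ := hF.contDiffAt.hasStrictFDerivAt (by simp)
  set c : ℝ := ‖F' (1, 0)‖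
  have hc : 0 < c := norm_pos_iff.2 hz₀
  have h1 := hstrict.isLittleO.def (half_pos hc)
  rw [nhds_prod_eq] at h1
  obtain ⟨U, hU, hUU⟩ := mem_prod_same_iff.1 h1
  refine ⟨U, hU, ?_⟩
  set E := {x : ℝ | ∃ a ∈ N, (x, a) ∈ U ∧ F (x, a) = 0}
  have hE : ∀ x : E, ∃ a ∈ N, ((x : ℝ), a) ∈ U ∧ F (x, a) = 0 := fun x => x.2
  choose f hfN hfU hfF using hE
  set K : ℝ := 2 * (‖F' (0, 1)‖ + c / 2) / c
  have hK : 0 ≤ K := by positivity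
  refine volume_eq_zero_of_antilipschitz hN (K := ⟨K, hK⟩) (f := f) ?_ hfN
  refine AntilipschitzWith.of_le_mul_dist fun x y => ?_
  have h2 := hUU (Set.mk_mem_prod (hfU x) (hfU y))
  rw [Set.mem_ofPred_eq] at h2
  set h : ℝ := (x : ℝ) - y
  set k : ℝ := f x - f y
  have h3 : ((x : ℝ), f x) - ((y : ℝ), f y) = (h, k) := rfl
  have h4 : F' (h, k) = h • F' (1, 0) + k • F' (0, 1) := by
    rw [← map_smul, ← map_smul, ← map_add]
    simp
  simp only [hfF, h3, h4, sub_zero, zero_sub, norm_neg] at h2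
  have h5 : ‖((h, k) : ℝ × ℝ)‖ ≤ |h| + |k| := by
    rw [Prod.norm_def]
    exact max_le (by simp) (by simp)
  have h6 : ‖h • F' (1, 0)‖ ≤ ‖h • F' (1, 0) + k • F' (0, 1)‖ + ‖k • F' (0, 1)‖ := by
    simpa using norm_sub_le (h • F' (1, 0) + k • F' (0, 1)) (k • F' (0, 1))
  rw [norm_smul, norm_smul, Real.norm_eq_abs, Real.norm_eq_abs] at h6
  have h7 := mul_le_mul_of_nonneg_left h5 (half_pos hc).le
  have hd : dist x y = |h| := rfl
  have hd' : dist (f x) (f y) = |k| := rfl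
  rw [hd, hd']
  change |h| ≤ 2 * (‖F' (0, 1)‖ + c / 2) / c * |k|
  rw [div_mul_eq_mul_div, le_div_iff₀ hc]
  change |h| * c ≤ _ at h6
  linarith

/-- If no function `F(·, a)` vanishes to infinite order at a point, then the zeros `x` of the
functions `F(·, a)`, `a` in a null set, form a null set. -/
theorem volume_zero_set_eq_zero {F : ℝ × ℝ → ℂ} (hF : ContDiff ℝ ∞ F)
    (hord : ∀ x a : ℝ, ∃ n, iteratedDeriv n (fun x => F (x, a)) x ≠ 0) {N : Set ℝ}
    (hN : volume N = 0) : volume {x : ℝ | ∃ a ∈ N, F (x, a) = 0} = 0 := by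
  classical
  have hn : ∀ n, volume {x : ℝ | ∃ a ∈ N, partialFst (partialFst^[n] F) (x, a) ≠ 0 ∧
      partialFst^[n] F (x, a) = 0} = 0 := by
    intro n
    set G := partialFst^[n] F
    have hG : ContDiff ℝ ∞ G := contDiff_iterate_partialFst hF n
    set S : Set (ℝ × ℝ) := {z | partialFst G z ≠ 0}
    have hloc : ∀ z : ℝ × ℝ, z ∈ S →
        ∃ U ∈ 𝓝 z, volume {x : ℝ | ∃ a ∈ N, (x, a) ∈ U ∧ G (x, a) = 0} = 0 :=
      fun z hz => exists_nhds_volume_zero_set_eq_zero hG hz hN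
    choose! U hU hU0 using hloc
    obtain ⟨t, htS, htc, hcov⟩ := TopologicalSpace.countable_cover_nhdsWithin
      (f := U) (s := S) fun z hz => mem_nhdsWithin_of_mem_nhds (hU z hz)
    have : volume (⋃ z ∈ t, {x : ℝ | ∃ a ∈ N, (x, a) ∈ U z ∧ G (x, a) = 0}) = 0 :=
      (measure_biUnion_null_iff htc).2 fun z hz => hU0 z (htS hz)
    refine measure_mono_null ?_ this
    rintro x ⟨a, ha, hx1, hx2⟩
    obtain ⟨z, hz, hxz⟩ := Set.mem_iUnion₂.1 (hcov (show (x, a) ∈ S from hx1))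
    exact Set.mem_iUnion₂.2 ⟨z, hz, a, ha, hxz, hx2⟩
  refine measure_mono_null ?_ (measure_iUnion_null_iff.2 hn)
  rintro x ⟨a, ha, hx⟩
  have hex : ∃ n, partialFst^[n] F (x, a) ≠ 0 := by
    obtain ⟨n, h⟩ := hord x a
    rw [iteratedDeriv_eq_iterate_partialFst hF] at h
    exact ⟨n, h⟩
  obtain ⟨k, hk⟩ : ∃ k, Nat.find hex = k + 1 := by
    refine Nat.exists_eq_succ_of_ne_zero fun h0 => ?_
    have := Nat.find_spec hex
    rw [h0] at this
    exact this hx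
  refine Set.mem_iUnion.2 ⟨k, a, ha, ?_, ?_⟩
  · have := Nat.find_spec hex
    rwa [hk, Function.iterate_succ_apply'] at this
  · by_contra hne
    have := Nat.find_min' hex hne
    omega

theorem exists_iteratedDeriv_ne_zero {f : ℝ → ℂ} {x : ℝ} (hf : AnalyticAt ℝ f x)
    (hne : ∃ᶠ y in 𝓝 x, f y ≠ 0) : ∃ n, iteratedDeriv n f x ≠ 0 := by
  by_contra! h
  refine hne ?_
  have : analyticOrderAt f x = ⊤ := by
    refine ENat.eq_top_iff_forall_ge.2 fun n => ?_
    exact (natCast_le_analyticOrderAt_iff_iteratedDeriv_eq_zero hf).2 fun i _ => h i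
  filter_upwards [analyticOrderAt_eq_top.1 this] with y hy
  simpa using hy

theorem contDiff_matrix_det {E : Type*} [NormedAddCommGroup E] [NormedSpace ℝ E] {n : Type*}
    [Fintype n] [DecidableEq n] {A : E → Matrix n n ℂ}
    (hA : ∀ j k, ContDiff ℝ ∞ fun z => A z j k) : ContDiff ℝ ∞ fun z => (A z).det := by
  simp only [Matrix.det_apply']
  exact ContDiff.sum fun σ _ => contDiff_const.mul (contDiff_prod fun i _ => hA _ _)

/-- At a primitive resonance, the quasi-positions at which the Bloch matrix has an eigenangle in a
given null set form a null set. -/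
theorem volume_eigenangle_mem_eq_zero {p : ℤ} {q : ℕ} [NeZero q] {β μ : ℝ}
    (hpq : IsCoprime p (q : ℤ)) (hper : Function.Periodic (freePhase p q β) q) (hμ : μ ≠ 0)
    {N : Set ℝ} (hN : volume N = 0) :
    volume {x : ℝ | ∃ a ∈ N,
      (blochMatrix q p q β x μ - Complex.exp (a * Complex.I) • 1).det = 0} = 0 := by
  refine volume_zero_set_eq_zero (F := fun z =>
    (blochMatrix q p q β z.1 μ - Complex.exp (z.2 * Complex.I) • 1).det) ?_ (fun x a => ?_) hN
  · have hofReal : ContDiff ℝ ∞ (fun x : ℝ => (x : ℂ)) := Complex.ofRealCLM.contDiff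
    refine contDiff_matrix_det fun j k => ?_
    simp only [Matrix.sub_apply, blochMatrix, Matrix.of_apply, Matrix.smul_apply, smul_eq_mul]
    have h1 : ContDiff ℝ ∞ fun z : ℝ × ℝ => Complex.exp (-Complex.I * μ *
        Real.cos (z.1 + 2 * Real.pi * (j : ℝ) / q)) := by
      refine (contDiff_const.mul ?_).cexp
      exact hofReal.comp (Real.contDiff_cos.comp (contDiff_fst.add contDiff_const))
    have h2 : ContDiff ℝ ∞ fun z : ℝ × ℝ => Complex.exp (z.2 * Complex.I) :=
      ((hofReal.comp contDiff_snd).mul contDiff_const).cexp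
    exact (h1.mul contDiff_const).sub (h2.mul contDiff_const)
  · have h0 := exists_det_blochMatrix_ne_zero hpq hper hμ (Complex.exp_ne_zero (a * Complex.I)) x
    refine exists_iteratedDeriv_ne_zero (f := fun x : ℝ =>
      (blochMatrix q p q β x μ - Complex.exp (a * Complex.I) • 1).det) ?_ h0
    have h1 := analyticOnNhd_det_complexBloch p q β μ (Complex.exp (a * Complex.I)) (x : ℂ)
      (Set.mem_univ _)
    have h2 : AnalyticAt ℝ (fun y : ℝ => (y : ℂ)) x := Complex.ofRealCLM.analyticAt x
    have h3 := (h1.restrictScalars (𝕜 := ℝ)).comp h2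
    refine h3.congr (Eventually.of_forall fun y => ?_)
    simp only [blochMatrix_eq_complexBloch, Function.comp_apply]

/-! ### Functional calculus of a unitary in terms of the eigenangle -/

section Calculus

variable {A : Type*} [CStarAlgebra A]

/-- The eigenangle, as a function on the spectrum of a unitary. -/
def spectrumAngle {u : A} (hu : u ∈ unitary A) : C(spectrum ℂ u, Torus) where
  toFun z := AddCircle.homeomorphCircle'.symm ⟨z, spectrum.subset_circle_of_unitary hu z.2⟩
  continuous_toFun := AddCircle.homeomorphCircle'.symm.continuous.comp
    (continuous_subtype_val.subtype_mk _)

theorem toCircle_spectrumAngle {u : A} (hu : u ∈ unitary A) (z : spectrum ℂ u) :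
    (AddCircle.toCircle (spectrumAngle hu z) : ℂ) = z := by
  have h : ∀ θ : Torus, AddCircle.toCircle θ = AddCircle.homeomorphCircle' θ := by
    intro θ
    induction θ using QuotientAddGroup.induction_on with
    | H x =>
      rw [AddCircle.toCircle_apply_mk]
      change Circle.exp _ = Circle.exp x
      congr 1
      field_simp
  rw [h]
  exact congrArg (fun c : Circle => (c : ℂ))
    (AddCircle.homeomorphCircle'.apply_symm_apply (⟨z, spectrum.subset_circle_of_unitary hu z.2⟩ :
      Circle))

/-- The functional calculus `f ↦ f(u)` for functions of the eigenangle. -/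
def angleCalculus {u : A} (hu : u ∈ unitary A) : C(Torus, ℂ) →⋆ₐ[ℂ] A :=
  (cfcHom (R := ℂ) (isStarNormal_of_mem_unitary hu)).comp
    (ContinuousMap.compStarAlgHom' ℂ ℂ (spectrumAngle hu))

theorem angleCalculus_fourier_one {u : A} (hu : u ∈ unitary A) :
    angleCalculus hu (fourier 1) = u := by
  conv_rhs => rw [← cfcHom_id (R := ℂ) (isStarNormal_of_mem_unitary hu)]
  change cfcHom _ _ = _
  congr 1
  ext z
  change fourier 1 (spectrumAngle hu z) = (z : ℂ)
  rw [fourier_one, toCircle_spectrumAngle]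

theorem angleCalculus_fourier (u : unitary A) (n : ℤ) :
    angleCalculus u.2 (fourier n) = ((u ^ n : unitary A) : A) := by
  have hmul : ∀ m k : ℤ, angleCalculus u.2 (fourier (m + k))
      = angleCalculus u.2 (fourier m) * angleCalculus u.2 (fourier k) := by
    intro m k
    rw [← map_mul]
    congr 1
    ext x
    exact fourier_add
  have hone := angleCalculus_fourier_one u.2
  have hneg : angleCalculus u.2 (fourier (-1)) = star (u : A) := by
    conv_rhs => rw [← hone]
    rw [← map_star]
    congr 1
    ext x
    exact fourier_neg
  induction n using Int.induction_on with
  | zero =>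
    have : (fourier 0 : C(Torus, ℂ)) = 1 := by
      ext x
      exact fourier_zero
    simp [this]
  | succ n ih =>
    rw [hmul, ih, hone, zpow_add_one]
    rfl
  | pred n ih =>
    rw [sub_eq_add_neg, hmul, ih, hneg, zpow_add, zpow_neg_one]
    rfl

theorem norm_angleCalculus_le {u : A} (hu : u ∈ unitary A) (f : C(Torus, ℂ)) :
    ‖angleCalculus hu f‖ ≤ ‖f‖ :=
  NonUnitalStarAlgHom.norm_apply_le (angleCalculus hu) f

theorem angleCalculus_eq_zero {u : A} (hu : u ∈ unitary A) {f : C(Torus, ℂ)}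
    (hf : ∀ θ : Torus, (AddCircle.toCircle θ : ℂ) ∈ spectrum ℂ u → f θ = 0) :
    angleCalculus hu f = 0 := by
  have : (ContinuousMap.compStarAlgHom' ℂ ℂ (spectrumAngle hu)) f = 0 := by
    ext z
    refine hf _ ?_
    rw [toCircle_spectrumAngle]
    exact z.2
  exact (congrArg (cfcHom (R := ℂ) (isStarNormal_of_mem_unitary hu)) this).trans (map_zero _)

end Calculus

/-! ### Existence of spectral measures -/

section SpectralMeasure

variable {X : Type*} [TopologicalSpace X]
  {H : Type*} [NormedAddCommGroup H] [InnerProductSpace ℂ H] [CompleteSpace H]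

/-- A real continuous function, seen as a complex one. -/
def toComplex (f : C(X, ℝ)) : C(X, ℂ) := ⟨fun x => (f x : ℂ), by fun_prop⟩

theorem inner_starAlgHom_nonneg (Φ : C(X, ℂ) →⋆ₐ[ℂ] (H →L[ℂ] H)) (ψ : H) {f : C(X, ℝ)}
    (hf : ∀ x, 0 ≤ f x) : 0 ≤ (inner ℂ ψ (Φ (toComplex f) ψ)).re := by
  set k : C(X, ℝ) := ⟨fun x => Real.sqrt (f x), by fun_prop⟩
  have hk : toComplex f = star (toComplex k) * toComplex k := by
    ext x
    change (f x : ℂ) = star ((Real.sqrt (f x) : ℝ) : ℂ) * ((Real.sqrt (f x) : ℝ) : ℂ)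
    rw [Complex.star_def, Complex.conj_ofReal, ← Complex.ofReal_mul, Real.mul_self_sqrt (hf x)]
  rw [hk, map_mul, map_star, ContinuousLinearMap.star_eq_adjoint,
    mul_apply_eq_comp, ContinuousLinearMap.adjoint_inner_right]
  exact inner_self_nonneg (𝕜 := ℂ)

theorem inner_starAlgHom_im (Φ : C(X, ℂ) →⋆ₐ[ℂ] (H →L[ℂ] H)) (ψ : H) (f : C(X, ℝ)) :
    (inner ℂ ψ (Φ (toComplex f) ψ)).im = 0 := by
  have h : star (toComplex f) = toComplex f := by
    ext x
    exact Complex.conj_ofReal _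
  have h2 : star (Φ (toComplex f)) = Φ (toComplex f) := by rw [← map_star, h]
  rw [ContinuousLinearMap.star_eq_adjoint] at h2
  rw [← Complex.conj_eq_iff_im]
  conv_rhs => rw [← h2, ContinuousLinearMap.adjoint_inner_right]
  exact inner_conj_symm _ _

/-- The positive functional `f ↦ ⟪ψ, Φ(f) ψ⟫`. -/
def vectorState (Φ : C(X, ℂ) →⋆ₐ[ℂ] (H →L[ℂ] H)) (ψ : H) :
    CompactlySupportedContinuousMap X ℝ →ₚ[ℝ] ℝ where
  toFun f := (inner ℂ ψ (Φ (toComplex f.toContinuousMap) ψ)).re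
  map_add' f g := by
    have : toComplex (f + g).toContinuousMap
        = toComplex f.toContinuousMap + toComplex g.toContinuousMap := by
      ext x
      exact Complex.ofReal_add _ _
    rw [this, map_add, add_apply, inner_add_right, Complex.add_re]
  map_smul' c f := by
    have : toComplex (c • f).toContinuousMap = (c : ℂ) • toComplex f.toContinuousMap := by
      ext x
      exact Complex.ofReal_mul _ _
    rw [this, map_smul, smul_apply, inner_smul_right, Complex.re_ofReal_mul]
    rfl
  monotone' f g hfg := by
    have h : toComplex g.toContinuousMap = toComplex f.toContinuousMap
        + toComplex (g.toContinuousMap - f.toContinuousMap) := by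
      ext x
      change (g x : ℂ) = (f x : ℂ) + ((g x - f x : ℝ) : ℂ)
      push_cast
      ring
    have h2 := inner_starAlgHom_nonneg Φ ψ (f := g.toContinuousMap - f.toContinuousMap)
      fun x => sub_nonneg.2 (hfg x)
    change (inner ℂ ψ (Φ (toComplex f.toContinuousMap) ψ)).re ≤
      (inner ℂ ψ (Φ (toComplex g.toContinuousMap) ψ)).re
    rw [h, map_add, add_apply, inner_add_right, Complex.add_re]
    linarith

variable [CompactSpace X] [T2Space X] [MeasurableSpace X] [BorelSpace X]

theorem exists_measure_inner_eq_integral (Φ : C(X, ℂ) →⋆ₐ[ℂ] (H →L[ℂ] H)) (ψ : H) :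
    ∃ m : Measure X, IsFiniteMeasure m ∧ ∀ f : C(X, ℂ), inner ℂ ψ (Φ f ψ) = ∫ x, f x ∂m := by
  set m := RealRMK.rieszMeasure (vectorState Φ ψ)
  have hm : IsFiniteMeasure m := inferInstance
  have hreal : ∀ f : C(X, ℝ), inner ℂ ψ (Φ (toComplex f) ψ) = ((∫ x, f x ∂m : ℝ) : ℂ) := by
    intro f
    have h := RealRMK.integral_rieszMeasure (vectorState Φ ψ)
      ⟨f, HasCompactSupport.of_compactSpace _⟩
    refine Complex.ext ?_ ?_
    · rw [Complex.ofReal_re]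
      exact h.symm
    · rw [Complex.ofReal_im, inner_starAlgHom_im]
  refine ⟨m, hm, fun f => ?_⟩
  set f₁ : C(X, ℝ) := ⟨fun x => (f x).re, by fun_prop⟩
  set f₂ : C(X, ℝ) := ⟨fun x => (f x).im, by fun_prop⟩
  have hf : f = toComplex f₁ + Complex.I • toComplex f₂ := by
    ext x
    change f x = ((f x).re : ℂ) + Complex.I * ((f x).im : ℂ)
    rw [mul_comm, Complex.re_add_im]
  have hint : Integrable (fun x => f x) m :=
    f.continuous.integrable_of_hasCompactSupport (HasCompactSupport.of_compactSpace _)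
  rw [← integral_re_add_im hint]
  conv_lhs => rw [hf]
  rw [map_add, map_smul, add_apply, smul_apply,
    inner_add_right, inner_smul_right, hreal, hreal, mul_comm Complex.I]
  rfl

end SpectralMeasure

/-! ### The propagator in the Bloch representation -/

local notation "haar" => (AddCircle.haarAddCircle : Measure Torus)

/-- The point `2πl/q` of the circle. -/
def gridPoint (q : ℕ) (l : ℤ) : Torus := ((2 * Real.pi * l / q : ℝ) : Torus)

theorem gridPoint_add (q : ℕ) (k l : ℤ) : gridPoint q (k + l) = gridPoint q k + gridPoint q l := by
  rw [gridPoint, gridPoint, gridPoint, ← AddCircle.coe_add]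
  congr 1
  push_cast
  ring

theorem gridPoint_neg (q : ℕ) (l : ℤ) : gridPoint q (-l) = -gridPoint q l := by
  rw [gridPoint, gridPoint, ← AddCircle.coe_neg]
  congr 1
  push_cast
  ring

theorem gridPoint_periodic (q : ℕ) [NeZero q] : Function.Periodic (gridPoint q) q := by
  intro l
  have hq : (q : ℝ) ≠ 0 := NeZero.ne _
  rw [gridPoint_add]
  have : gridPoint q q = 0 := by
    rw [gridPoint, ← AddCircle.coe_period]
    congr 1
    push_cast
    field_simp
  rw [this, add_zero]

theorem fourier_gridPoint (q : ℕ) (n l : ℤ) :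
    fourier n (gridPoint q l) = Complex.exp (2 * Real.pi * Complex.I * l * n / q) := by
  have hpi : (Real.pi : ℂ) ≠ 0 := by exact_mod_cast Real.pi_ne_zero
  rw [gridPoint, fourier_coe_apply]
  congr 1
  push_cast
  field_simp

/-- The translation `ψ ↦ ψ(· + x)`. -/
def translate (x : Torus) : L2Torus →L[ℂ] L2Torus :=
  (Lp.compMeasurePreservingₗᵢ ℂ (fun θ : Torus => θ + x)
    (measurePreserving_add_right haar x)).toContinuousLinearMap

theorem coeFn_translate (x : Torus) (ψ : L2Torus) :
    translate x ψ =ᵐ[haar] fun θ => ψ (θ + x) :=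
  Lp.coeFn_compMeasurePreserving ψ (measurePreserving_add_right haar x)

theorem translate_fourierLp (x : Torus) (n : ℤ) :
    translate x (fourierLp 2 n) = fourier n x • fourierLp (T := 2 * Real.pi) 2 n := by
  apply Lp.ext
  have h := (measurePreserving_add_right haar x).quasiMeasurePreserving.ae
    (coeFn_fourierLp (T := 2 * Real.pi) 2 n)
  filter_upwards [coeFn_translate x (fourierLp 2 n), h, coeFn_fourierLp (T := 2 * Real.pi) 2 n,
    Lp.coeFn_smul (fourier n x) (fourierLp (T := 2 * Real.pi) 2 n)] with θ h1 h2 h3 h4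
  rw [h1, h2, h4, Pi.smul_apply, h3, smul_eq_mul, mul_comm (fourier n x), fourier_apply, fourier_apply,
    fourier_apply, smul_add, AddCircle.toCircle_add, Circle.coe_mul]

/-- At a resonance the free rotation is a finite combination of translations. -/
theorem freeRotation_eq_sum {β τ : ℝ} {p : ℤ} {q : ℕ} [NeZero q] (hτ : τ = 2 * Real.pi * p / q)
    (ha : Function.Periodic (freePhase p q β) q) (ψ : L2Torus) :
    freeRotation β τ ψ
      = ∑ l ∈ Finset.range q, hopping p q β l • translate (gridPoint q (-l)) ψ := by
  have h : ((freeRotation β τ).toContinuousLinearEquiv : L2Torus →L[ℂ] L2Torus)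
      = ∑ l ∈ Finset.range q, hopping p q β l • translate (gridPoint q (-l)) := by
    refine ContinuousLinearMap.ext_on (s := Set.range (fourierLp (T := 2 * Real.pi) 2)) ?_ ?_
    · rw [Submodule.dense_iff_topologicalClosure_eq_top]
      exact span_fourierLp_closure_eq_top (by simp)
    · rintro _ ⟨n, rfl⟩
      change freeRotation β τ (fourierLp 2 n) = _
      rw [freeRotation_fourierLp, freePhase_eq_circle β hτ, ← sum_hopping_mul_exp ha n,
        sum_apply, Finset.sum_smul]
      refine Finset.sum_congr rfl fun l _ => ?_
      rw [smul_apply, translate_fourierLp, fourier_gridPoint, smul_smul]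
      congr 3
      push_cast
      ring
  have h2 := DFunLike.congr_fun h ψ
  rw [sum_apply] at h2
  exact h2

theorem coeFn_kick (μ : ℝ) (ψ : L2Torus) : kick μ ψ =ᵐ[haar] fun θ => (kickFun μ θ : ℂ) * ψ θ :=
  (memLp_mul (kickFun μ) ψ).coeFn_toLp

theorem ae_forall_gridPoint (q : ℕ) {P : Torus → Prop} (hP : ∀ᵐ θ ∂haar, P θ) :
    ∀ᵐ θ ∂haar, ∀ l : ℤ, P (θ + gridPoint q l) :=
  ae_all_iff.2 fun l =>
    (measurePreserving_add_right haar (gridPoint q l)).quasiMeasurePreserving.ae hP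

/-- The values of a function at the points `θ + 2πj/q`. -/
def fiber (q : ℕ) (ψ : L2Torus) (θ : Torus) (j : Fin q) : ℂ := ψ (θ + gridPoint q (j : ℕ))

/-- The Bloch matrix of the propagator. -/
def fiberMatrix (p : ℤ) (q : ℕ) (β μ : ℝ) (θ : Torus) : Matrix (Fin q) (Fin q) ℂ :=
  freeMatrix q p q β * kickDiag q μ θ

theorem fiber_propagator {β τ μ : ℝ} {p : ℤ} {q : ℕ} [NeZero q] (hτ : τ = 2 * Real.pi * p / q)
    (ha : Function.Periodic (freePhase p q β) q) (ψ : L2Torus) :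
    ∀ᵐ θ ∂haar, fiber q (propagator β τ μ ψ) θ
      = (fiberMatrix p q β μ θ).mulVec (fiber q ψ θ) := by
  have h1 : ∀ᵐ θ ∂haar, propagator β τ μ ψ θ
      = ∑ l ∈ Finset.range q, hopping p q β l * kick μ ψ (θ + gridPoint q (-l)) := by
    rw [propagator, isometryEquiv_mul_apply, freeRotation_eq_sum hτ ha]
    have h2 : ∀ᵐ θ ∂haar, ∀ l : ℕ, translate (gridPoint q (-l)) (kick μ ψ) θ
        = kick μ ψ (θ + gridPoint q (-l)) :=
      ae_all_iff.2 fun l => coeFn_translate _ _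
    have h3 : ∀ᵐ θ ∂haar, ∀ l : ℕ,
        (hopping p q β l • translate (gridPoint q (-l)) (kick μ ψ) : L2Torus) θ
          = hopping p q β l * translate (gridPoint q (-l)) (kick μ ψ) θ :=
      ae_all_iff.2 fun l => Lp.coeFn_smul _ _
    filter_upwards [h2, h3, Lp.coeFn_finsetSum (Finset.range q) fun l =>
      hopping p q β l • translate (gridPoint q (-l)) (kick μ ψ)] with θ h2 h3 h4
    rw [h4, Finset.sum_apply]
    exact Finset.sum_congr rfl fun l _ => by rw [h3, h2]
  filter_upwards [ae_forall_gridPoint q h1, ae_forall_gridPoint q (coeFn_kick μ ψ)] with θ h1 h2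
  funext j
  rw [fiber, h1]
  have hper : Function.Periodic (fun l : ℤ => hopping p q β l *
      kick μ ψ (θ + gridPoint q (j : ℕ) + gridPoint q (-l))) q := by
    intro l
    simp only [hopping_periodic p q β l, gridPoint_neg, gridPoint_periodic q l]
  rw [← sum_range_periodic_sub hper (j : ℕ), ← Fin.sum_univ_eq_sum_range
    (fun k : ℕ => hopping p q β ((j : ℕ) - k) *
      kick μ ψ (θ + gridPoint q (j : ℕ) + gridPoint q (-((j : ℕ) - k))))]
  rw [Matrix.mulVec, dotProduct]
  refine Finset.sum_congr rfl fun k _ => ?_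
  have : θ + gridPoint q (j : ℕ) + gridPoint q (-((j : ℕ) - (k : ℕ))) = θ + gridPoint q (k : ℕ) := by
    rw [add_assoc, ← gridPoint_add]
    congr 2
    ring
  rw [this, h2, fiberMatrix, kickDiag, Matrix.mul_diagonal, freeMatrix_apply, mul_assoc]
  simp only [fiber, gridPoint, Int.cast_natCast]

theorem fiberMatrix_mem_unitary (p : ℤ) (q : ℕ) [NeZero q] (β μ : ℝ) (θ : Torus) :
    fiberMatrix p q β μ θ ∈ Matrix.unitaryGroup (Fin q) ℂ :=
  mul_mem (freeMatrix_mem_unitary p q β) (diagonal_mem_unitary _)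

/-- The Bloch matrix of the propagator, as a unitary. -/
def fiberUnitary (p : ℤ) (q : ℕ) [NeZero q] (β μ : ℝ) (θ : Torus) :
    unitary (Matrix (Fin q) (Fin q) ℂ) := ⟨_, fiberMatrix_mem_unitary p q β μ θ⟩

theorem fiber_propagator_zpow {β τ μ : ℝ} {p : ℤ} {q : ℕ} [NeZero q]
    (hτ : τ = 2 * Real.pi * p / q) (ha : Function.Periodic (freePhase p q β) q) (ψ : L2Torus)
    (n : ℤ) : ∀ᵐ θ ∂haar, fiber q ((propagator β τ μ ^ n) ψ) θ
      = ((fiberUnitary p q β μ θ ^ n : unitary (Matrix (Fin q) (Fin q) ℂ)) :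
          Matrix (Fin q) (Fin q) ℂ).mulVec (fiber q ψ θ) := by
  induction n using Int.induction_on with
  | zero => exact Eventually.of_forall fun θ => by simp
  | succ n ih =>
    filter_upwards [ih, fiber_propagator (μ := μ) hτ ha ((propagator β τ μ ^ (n : ℤ)) ψ)]
      with θ h1 h2
    rw [add_comm, zpow_add, zpow_one, isometryEquiv_mul_apply, h2, h1, zpow_add, zpow_one,
      Matrix.mulVec_mulVec]
    rfl
  | pred n ih =>
    filter_upwards [ih, fiber_propagator (μ := μ) hτ ha ((propagator β τ μ ^ (-(n : ℤ) - 1)) ψ)]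
      with θ h1 h2
    rw [← isometryEquiv_mul_apply, ← zpow_one_add, add_sub_cancel, h1] at h2
    have h3 : fiberUnitary p q β μ θ ^ (-(n : ℤ) - 1)
        = (fiberUnitary p q β μ θ)⁻¹ * fiberUnitary p q β μ θ ^ (-(n : ℤ)) := by
      rw [sub_eq_neg_add, zpow_add, zpow_neg_one]
    have h4 : (((fiberUnitary p q β μ θ)⁻¹ : unitary (Matrix (Fin q) (Fin q) ℂ)) :
        Matrix (Fin q) (Fin q) ℂ) * fiberMatrix p q β μ θ = 1 :=
      congrArg Subtype.val (inv_mul_cancel (fiberUnitary p q β μ θ))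
    rw [h3, Submonoid.coe_mul, ← Matrix.mulVec_mulVec, h2, Matrix.mulVec_mulVec, h4,
      Matrix.one_mulVec]

open scoped Matrix.Norms.L2Operator

/-! ### Direct integral form of the functional calculus -/

theorem norm_star_dotProduct_mulVec_le {n : Type*} [Fintype n] [DecidableEq n] (M : Matrix n n ℂ)
    (v : n → ℂ) : ‖star v ⬝ᵥ M.mulVec v‖ ≤ ‖M‖ * ∑ j, ‖v j‖ ^ 2 := by
  set x : EuclideanSpace ℂ n := WithLp.toLp 2 v
  have h1 : star v ⬝ᵥ M.mulVec v = inner ℂ x (WithLp.toLp 2 (M.mulVec v)) := by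
    rw [EuclideanSpace.inner_toLp_toLp, dotProduct_comm]
  have h2 := Matrix.l2_opNorm_mulVec M x
  have h3 : ∑ j, ‖v j‖ ^ 2 = ‖x‖ ^ 2 := (EuclideanSpace.norm_sq_eq x).symm
  rw [h1, h3]
  calc _ ≤ ‖x‖ * ‖(WithLp.toLp 2 (M.mulVec v) : EuclideanSpace ℂ n)‖ := norm_inner_le_norm _ _
    _ ≤ ‖x‖ * (‖M‖ * ‖x‖) := by gcongr; exact h2
    _ = _ := by ring

/-- The quadratic form of `f(V(θ))` at the fibre of `ψ`. -/
def fiberForm (p : ℤ) (q : ℕ) [NeZero q] (β μ : ℝ) (ψ : L2Torus) (f : C(Torus, ℂ)) (θ : Torus) :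
    ℂ :=
  star (fiber q ψ θ) ⬝ᵥ (angleCalculus (fiberUnitary p q β μ θ).2 f).mulVec (fiber q ψ θ)

/-- The squared norm of the fibre of `ψ`. -/
def fiberNormSq (q : ℕ) (ψ : L2Torus) (θ : Torus) : ℝ := ∑ j, ‖fiber q ψ θ j‖ ^ 2

theorem integrable_fiberNormSq (q : ℕ) (ψ : L2Torus) : Integrable (fiberNormSq q ψ) haar := by
  refine integrable_finsetSum _ fun j _ => ?_
  have h : Integrable (fun θ => ‖ψ θ‖ ^ 2) haar := (Lp.memLp ψ).integrable_norm_pow two_ne_zero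
  exact h.comp_add_right (gridPoint q (j : ℕ))

theorem norm_fiberForm_le (p : ℤ) (q : ℕ) [NeZero q] (β μ : ℝ) (ψ : L2Torus) (f : C(Torus, ℂ))
    (θ : Torus) : ‖fiberForm p q β μ ψ f θ‖ ≤ ‖f‖ * fiberNormSq q ψ θ := by
  refine (norm_star_dotProduct_mulVec_le _ _).trans ?_
  refine mul_le_mul_of_nonneg_right (norm_angleCalculus_le _ f) ?_
  exact Finset.sum_nonneg fun j _ => by positivity

theorem integrable_fiberForm {p : ℤ} {q : ℕ} [NeZero q] {β μ : ℝ} {ψ : L2Torus} {f : C(Torus, ℂ)}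
    (hf : AEStronglyMeasurable (fiberForm p q β μ ψ f) haar) :
    Integrable (fiberForm p q β μ ψ f) haar :=
  ((integrable_fiberNormSq q ψ).const_mul ‖f‖).mono' hf
    (Eventually.of_forall fun θ => norm_fiberForm_le p q β μ ψ f θ)

theorem fiberForm_add (p : ℤ) (q : ℕ) [NeZero q] (β μ : ℝ) (ψ : L2Torus) (f g : C(Torus, ℂ)) :
    fiberForm p q β μ ψ (f + g) = fiberForm p q β μ ψ f + fiberForm p q β μ ψ g := by
  funext θ
  simp only [fiberForm, Pi.add_apply, map_add, Matrix.add_mulVec, dotProduct_add]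

theorem fiberForm_smul (p : ℤ) (q : ℕ) [NeZero q] (β μ : ℝ) (ψ : L2Torus) (c : ℂ)
    (f : C(Torus, ℂ)) : fiberForm p q β μ ψ (c • f) = c • fiberForm p q β μ ψ f := by
  funext θ
  simp only [fiberForm, Pi.smul_apply, map_smul, Matrix.smul_mulVec, dotProduct_smul]

/-- The pairing of two fibres integrates to the inner product. -/
theorem integral_star_fiber_dotProduct (q : ℕ) (ψ χ : L2Torus) :
    Integrable (fun θ => star (fiber q ψ θ) ⬝ᵥ fiber q χ θ) haar ∧
      ∫ θ, star (fiber q ψ θ) ⬝ᵥ fiber q χ θ ∂haar = q * inner ℂ ψ χ := by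
  have hint : Integrable (fun θ => inner ℂ (ψ θ) (χ θ)) haar := L2.integrable_inner ψ χ
  have heq : ∀ j : Fin q, ∀ θ, star (fiber q ψ θ) j * fiber q χ θ j
      = inner ℂ (ψ (θ + gridPoint q (j : ℕ))) (χ (θ + gridPoint q (j : ℕ))) := by
    intro j θ
    rw [RCLike.inner_apply, mul_comm]
    rfl
  have hj : ∀ j : Fin q, Integrable (fun θ => star (fiber q ψ θ) j * fiber q χ θ j) haar := by
    intro j
    simp only [heq]
    exact hint.comp_add_right (gridPoint q (j : ℕ))
  refine ⟨integrable_finsetSum _ fun j _ => hj j, ?_⟩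
  simp only [dotProduct]
  rw [integral_finsetSum _ fun j _ => hj j]
  have hval : ∀ j : Fin q, ∫ θ, star (fiber q ψ θ) j * fiber q χ θ j ∂haar = inner ℂ ψ χ := by
    intro j
    simp only [heq]
    rw [integral_add_right_eq_self (fun θ => inner ℂ (ψ θ) (χ θ)) (gridPoint q (j : ℕ)),
      ← L2.inner_def]
  simp only [hval, Finset.sum_const, Finset.card_univ, Fintype.card_fin, nsmul_eq_mul]

/-- The functional calculus of the propagator is the direct integral of those of its fibres. -/
theorem inner_angleCalculus_eq_integral {β τ μ : ℝ} {p : ℤ} {q : ℕ} [NeZero q]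
    (hτ : τ = 2 * Real.pi * p / q) (ha : Function.Periodic (freePhase p q β) q) (ψ : L2Torus)
    (f : C(Torus, ℂ)) :
    AEStronglyMeasurable (fiberForm p q β μ ψ f) haar ∧
      q * inner ℂ ψ (angleCalculus (Unitary.linearIsometryEquiv.symm (propagator β τ μ)).2 f ψ)
        = ∫ θ, fiberForm p q β μ ψ f θ ∂haar := by
  set Φ := angleCalculus (Unitary.linearIsometryEquiv.symm (propagator β τ μ)).2
  have hmem : f ∈ closure (Submodule.span ℂ (Set.range (@fourier (2 * Real.pi))) :
      Set C(Torus, ℂ)) := by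
    have h := span_fourier_closure_eq_top (T := 2 * Real.pi)
    rw [← Submodule.topologicalClosure_coe, h]
    trivial
  have hspan : ∀ g ∈ Submodule.span ℂ (Set.range (@fourier (2 * Real.pi))),
      AEStronglyMeasurable (fiberForm p q β μ ψ g) haar ∧
        q * inner ℂ ψ (Φ g ψ) = ∫ θ, fiberForm p q β μ ψ g θ ∂haar := by
    intro g hg
    induction hg using Submodule.span_induction with
    | mem g hg =>
      obtain ⟨n, rfl⟩ := hg
      have hae : fiberForm p q β μ ψ (fourier n) =ᵐ[haar]
          fun θ => star (fiber q ψ θ) ⬝ᵥ fiber q ((propagator β τ μ ^ n) ψ) θ := by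
        filter_upwards [fiber_propagator_zpow (μ := μ) hτ ha ψ n] with θ h
        rw [fiberForm, angleCalculus_fourier, h]
      have h := integral_star_fiber_dotProduct q ψ ((propagator β τ μ ^ n) ψ)
      refine ⟨h.1.aestronglyMeasurable.congr hae.symm, ?_⟩
      rw [integral_congr_ae hae, h.2, angleCalculus_fourier, ← map_zpow]
      rfl
    | zero =>
      have : fiberForm p q β μ ψ 0 = 0 := by
        funext θ
        simp [fiberForm]
      rw [this]
      exact ⟨aestronglyMeasurable_zero, by simp⟩
    | add g h _ _ ihg ihh =>
      rw [fiberForm_add]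
      refine ⟨ihg.1.add ihh.1, ?_⟩
      simp only [Pi.add_apply]
      rw [integral_add (integrable_fiberForm ihg.1) (integrable_fiberForm ihh.1), ← ihg.2, ← ihh.2,
        map_add, add_apply, inner_add_right, mul_add]
    | smul c g _ ih =>
      rw [fiberForm_smul]
      refine ⟨ih.1.const_smul c, ?_⟩
      simp only [Pi.smul_apply]
      rw [integral_smul, ← ih.2, map_smul, smul_apply, inner_smul_right, smul_eq_mul]
      ring
  obtain ⟨g, hg, hlim⟩ := mem_closure_iff_seq_limit.1 hmem
  have hpt : ∀ θ, Tendsto (fun n => fiberForm p q β μ ψ (g n) θ) atTop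
      (𝓝 (fiberForm p q β μ ψ f θ)) := by
    intro θ
    have h1 : Tendsto (fun n => ‖g n - f‖ * fiberNormSq q ψ θ) atTop (𝓝 0) := by
      simpa using (tendsto_iff_norm_sub_tendsto_zero.1 hlim).mul_const (fiberNormSq q ψ θ)
    rw [tendsto_iff_norm_sub_tendsto_zero]
    refine squeeze_zero (fun n => norm_nonneg _) (fun n => ?_) h1
    have h2 := congrFun (fiberForm_add p q β μ ψ (g n - f) f) θ
    rw [sub_add_cancel, Pi.add_apply] at h2
    rw [h2, add_sub_cancel_right]
    exact norm_fiberForm_le p q β μ ψ _ θ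
  have hmeas : AEStronglyMeasurable (fiberForm p q β μ ψ f) haar :=
    aestronglyMeasurable_of_tendsto_ae atTop (fun n => (hspan _ (hg n)).1)
      (Eventually.of_forall hpt)
  refine ⟨hmeas, ?_⟩
  have hbound : ∀ᶠ n in atTop, ‖g n‖ ≤ ‖f‖ + 1 := by
    filter_upwards [hlim.norm.eventually_lt_const (lt_add_one ‖f‖)] with n hn using hn.le
  have hR : Tendsto (fun n => ∫ θ, fiberForm p q β μ ψ (g n) θ ∂haar) atTop
      (𝓝 (∫ θ, fiberForm p q β μ ψ f θ ∂haar)) := by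
    refine tendsto_integral_filter_of_dominated_convergence
      (fun θ => (‖f‖ + 1) * fiberNormSq q ψ θ)
      (Eventually.of_forall fun n => (hspan _ (hg n)).1) ?_
      ((integrable_fiberNormSq q ψ).const_mul _) (Eventually.of_forall hpt)
    filter_upwards [hbound] with n hn
    refine Eventually.of_forall fun θ => (norm_fiberForm_le p q β μ ψ (g n) θ).trans ?_
    exact mul_le_mul_of_nonneg_right hn (Finset.sum_nonneg fun j _ => by positivity)
  have hL : Tendsto (fun n => (q : ℂ) * inner ℂ ψ (Φ (g n) ψ)) atTop
      (𝓝 (q * inner ℂ ψ (Φ f ψ))) := by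
    have hΦ : Continuous Φ := by
      refine AddMonoidHomClass.continuous_of_bound Φ 1 fun f => ?_
      rw [one_mul]
      exact norm_angleCalculus_le _ f
    have h1 : Continuous fun h : C(Torus, ℂ) => (q : ℂ) * inner ℂ ψ (Φ h ψ) := by fun_prop
    exact (h1.tendsto f).comp hlim
  simp only [fun n => (hspan _ (hg n)).2] at hL
  exact tendsto_nhds_unique hL hR

/-! ### Absolute continuity -/

theorem volume_preimage_coe_eq_zero {K : Set Torus} (hK : volume K = 0) :
    volume {x : ℝ | (x : Torus) ∈ K} = 0 := by
  have h : ∀ n : ℤ, volume ({x : ℝ | (x : Torus) ∈ K} ∩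
      Set.Ioc (0 + n • (2 * Real.pi)) (0 + (n + 1) • (2 * Real.pi))) = 0 := by
    intro n
    have h1 := (AddCircle.measurePreserving_mk (2 * Real.pi)
      (0 + n • (2 * Real.pi))).quasiMeasurePreserving.preimage_null hK
    rw [Measure.restrict_apply' measurableSet_Ioc] at h1
    rw [add_zsmul, one_zsmul, ← add_assoc]
    exact h1
  refine measure_mono_null ?_ (measure_iUnion_null_iff.2 h)
  rw [← Set.inter_iUnion, iUnion_Ioc_add_zsmul Real.two_pi_pos, Set.inter_univ]

theorem volume_eq_zero_of_preimage_coe {E : Set Torus}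
    (hE : volume {x : ℝ | (x : Torus) ∈ E} = 0) : volume E = 0 := by
  set e := AddCircle.measurableEquivIoc (2 * Real.pi) 0
  have he : MeasurePreserving e volume (Measure.comap Subtype.val volume) :=
    AddCircle.measurePreserving_equivIoc (2 * Real.pi)
  have h1 : e ⁻¹' {x | ((x : ℝ) : Torus) ∈ E} = E := by
    ext θ
    change ((e θ : ℝ) : Torus) ∈ E ↔ _
    rw [show ((e θ : ℝ) : Torus) = θ from (AddCircle.equivIoc (2 * Real.pi) 0).symm_apply_apply θ]
  rw [← h1, he.measure_preimage_equiv, comap_subtype_coe_apply measurableSet_Ioc]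
  refine measure_mono_null ?_ hE
  rintro _ ⟨x, hx, rfl⟩
  exact hx

theorem haar_absolutelyContinuous_volume : haar ≪ (volume : Measure Torus) := by
  rw [AddCircle.volume_eq_smul_haarAddCircle]
  refine Measure.absolutelyContinuous_smul ?_
  simpa using Real.pi_pos

theorem mem_spectrum_fiberMatrix {p : ℤ} {q : ℕ} {β μ x : ℝ} {w : ℂ}
    (hw : w ∈ spectrum ℂ (fiberMatrix p q β μ x)) :
    (blochMatrix q p q β x μ - w • 1).det = 0 := by
  rw [Matrix.mem_spectrum_iff_isRoot_charpoly, fiberMatrix, Matrix.charpoly_mul_comm,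
    ← blochMatrix_eq_mul] at hw
  exact det_sub_smul_eq_zero_of_isRoot hw

theorem toCircle_coe (a : ℝ) : (AddCircle.toCircle (a : Torus) : ℂ) = Complex.exp (a * Complex.I) := by
  rw [AddCircle.toCircle_apply_mk, div_self Real.two_pi_pos.ne', one_mul, Circle.coe_exp]

theorem ae_disjoint_spectrum {p : ℤ} {q : ℕ} [NeZero q] {β μ : ℝ} (hpq : IsCoprime p (q : ℤ))
    (ha : Function.Periodic (freePhase p q β) q) (hμ : μ ≠ 0) {K : Set Torus}
    (hK : volume K = 0) :
    ∀ᵐ θ ∂haar, ∀ α ∈ K, (AddCircle.toCircle α : ℂ) ∉ spectrum ℂ (fiberMatrix p q β μ θ) := by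
  refine haar_absolutelyContinuous_volume.ae_le ?_
  refine volume_eq_zero_of_preimage_coe (measure_mono_null ?_
    (volume_eigenangle_mem_eq_zero hpq ha hμ (volume_preimage_coe_eq_zero hK)))
  intro x hx
  obtain ⟨α, hα, h⟩ : ∃ α ∈ K,
      (AddCircle.toCircle α : ℂ) ∈ spectrum ℂ (fiberMatrix p q β μ x) := by
    by_contra! hcon
    exact hx hcon
  obtain ⟨a, rfl⟩ := QuotientAddGroup.mk_surjective α
  refine ⟨a, hα, mem_spectrum_fiberMatrix ?_⟩
  rw [← toCircle_coe]
  exact h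

/-- At a primitive resonance with nonzero kick, the spectrum is purely absolutely continuous. -/
theorem hasPurelyACSpectrum_propagator {β τ μ : ℝ} {p : ℤ} {q : ℕ} [NeZero q]
    (hpq : IsCoprime p (q : ℤ)) (hτ : τ = 2 * Real.pi * p / q)
    (ha : Function.Periodic (freePhase p q β) q) (hμ : μ ≠ 0) :
    HasPurelyACSpectrum (propagator β τ μ) := by
  intro ψ
  set Φ := angleCalculus (Unitary.linearIsometryEquiv.symm (propagator β τ μ)).2 with hΦ
  obtain ⟨m, hm, hmΦ⟩ := exists_measure_inner_eq_integral Φ ψ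
  refine ⟨m, ⟨hm, fun n => ?_⟩, ?_⟩
  · rw [← hmΦ, hΦ, angleCalculus_fourier, ← map_zpow]
    rfl
  have hq : (q : ℂ) ≠ 0 := NeZero.ne _
  have hcompact : ∀ K : Set Torus, IsCompact K → volume K = 0 → m K = 0 := by
    intro K hK hK0
    set δ : ℕ → ℝ := fun n => 1 / ((n : ℝ) + 1)
    have hδ : ∀ n, 0 < δ n := fun n => Nat.one_div_pos_of_nat
    set g : ℕ → C(Torus, ℝ) := fun n =>
      ⟨fun x => (thickenedIndicator (hδ n) K x : ℝ),
        NNReal.continuous_coe.comp (thickenedIndicator (hδ n) K).continuous⟩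
    have hg1 : ∀ n, ‖toComplex (g n)‖ ≤ 1 := by
      intro n
      refine (ContinuousMap.norm_le _ zero_le_one).2 fun x => ?_
      change ‖((thickenedIndicator (hδ n) K x : ℝ) : ℂ)‖ ≤ 1
      rw [Complex.norm_real, NNReal.norm_eq]
      exact_mod_cast thickenedIndicator_le_one (hδ n) K x
    have hlim : Tendsto (fun n => ∫ θ, fiberForm p q β μ ψ (toComplex (g n)) θ ∂haar) atTop
        (𝓝 (∫ _ : Torus, (0 : ℂ) ∂haar)) := by
      refine tendsto_integral_of_dominated_convergence (fiberNormSq q ψ)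
        (fun n => (inner_angleCalculus_eq_integral hτ ha ψ _).1) (integrable_fiberNormSq q ψ)
        (fun n => Eventually.of_forall fun θ => ?_) ?_
      · refine (norm_fiberForm_le p q β μ ψ _ θ).trans ?_
        exact mul_le_of_le_one_left (Finset.sum_nonneg fun j _ => by positivity) (hg1 n)
      · filter_upwards [ae_disjoint_spectrum hpq ha hμ hK0] with θ hθ
        set S : Set Torus :=
          {α | (AddCircle.toCircle α : ℂ) ∈ spectrum ℂ (fiberMatrix p q β μ θ)}
        have hS : IsClosed S := (spectrum.isClosed _).preimage
          (continuous_subtype_val.comp AddCircle.continuous_toCircle)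
        obtain ⟨ε, hε, hKε⟩ := hK.exists_thickening_subset_open hS.isOpen_compl
          (fun α hα => hθ α hα)
        have hev : ∀ᶠ n in atTop, δ n < ε :=
          tendsto_one_div_add_atTop_nhds_zero_nat.eventually_lt_const hε
        refine tendsto_const_nhds.congr' ?_
        filter_upwards [hev] with n hn
        have : angleCalculus (fiberUnitary p q β μ θ).2 (toComplex (g n)) = 0 := by
          refine angleCalculus_eq_zero _ fun α hα => ?_
          have hout : α ∉ Metric.thickening (δ n) K := fun h =>
            hKε (Metric.thickening_mono hn.le K h) hα
          change ((thickenedIndicator (hδ n) K α : ℝ) : ℂ) = 0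
          rw [thickenedIndicator_zero (hδ n) K hout]
          simp
        rw [fiberForm, this, Matrix.zero_mulVec, dotProduct_zero]
    have hlim2 : Tendsto (fun n => ∫ x, g n x ∂m) atTop (𝓝 0) := by
      have h1 : ∀ n, ((∫ x, g n x ∂m : ℝ) : ℂ)
          = (q : ℂ)⁻¹ * ∫ θ, fiberForm p q β μ ψ (toComplex (g n)) θ ∂haar := by
        intro n
        rw [← (inner_angleCalculus_eq_integral hτ ha ψ _).2, inv_mul_cancel_left₀ hq, hmΦ,
          ← integral_complex_ofReal]
        rfl
      have h2 := hlim.const_mul (q : ℂ)⁻¹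
      simp only [← h1, integral_zero, mul_zero] at h2
      exact (Complex.continuous_re.tendsto 0).comp h2
    have hle : ∀ n, m.real K ≤ ∫ x, g n x ∂m := by
      intro n
      rw [← integral_indicator_one hK.measurableSet]
      refine integral_mono ((integrable_const (1 : ℝ)).indicator hK.measurableSet)
        ((g n).continuous.integrable_of_hasCompactSupport (HasCompactSupport.of_compactSpace _))
        fun x => ?_
      by_cases hx : x ∈ K
      · rw [Set.indicator_of_mem hx]
        change (1 : ℝ) ≤ (thickenedIndicator (hδ n) K x : ℝ)
        rw [thickenedIndicator_one (hδ n) K hx]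
        simp
      · rw [Set.indicator_of_notMem hx]
        exact NNReal.coe_nonneg _
    have h0 : m.real K ≤ 0 := ge_of_tendsto' hlim2 hle
    exact (measureReal_eq_zero_iff).1 (le_antisymm h0 measureReal_nonneg)
  refine Measure.AbsolutelyContinuous.mk fun s hs hs0 => ?_
  rw [hs.measure_eq_iSup_isCompact]
  simp only [ENNReal.iSup_eq_zero]
  exact fun K hKs hK => hcompact K hK (measure_mono_null hKs hs0)

end KickedRotor

end

theorem theorem1 (β τ μ : ℝ) (p : ℤ) (q : ℕ)
    (hres : KickedRotor.IsPrimitiveResonance β τ μ p q) (hμ : μ ≠ 0) :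
    (∀ w : Fin q → ℝ → ℝ → ℂ, KickedRotor.IsEigenvalueNumbering q p q β w →
      ∀ j : Fin q, ¬ KickedRotor.IsFlatBand q (fun ϑ => w j ϑ μ)) ∧
    KickedRotor.HasPurelyACSpectrum (KickedRotor.propagator β τ μ) := by
  obtain ⟨hq, hpq, hτ, hlen⟩ := hres
  have : NeZero q := ⟨hq.ne'⟩
  have ha := KickedRotor.freePhase_periodic hτ hlen.1.2
  exact ⟨fun w hw j => KickedRotor.not_isFlatBand hpq ha hμ hw j,
    KickedRotor.hasPurelyACSpectrum_propagator hpq hτ ha hμ⟩
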